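/- **Setting.** Let $G,D>0$, let $d\ge 0$ and $T\ge 2$ be integers, and let $\mathcal X\subseteq\mathbb R^d$ be closed and convex with $0\in\mathcal X$ and $\|x-y\|\le D$ for all $x,y\in\mathcal X$ (Euclidean norm). In round $t=1,\dots,T$ a learner submits $x_t\in\mathcal X$, suffers $f_t(x_t)$ and observes $\nabla f_t(x_t)$, where $f_t:\mathcal X\to\mathbb R$ is differentiable with $\|\nabla f_t(x)\|\le G$ on $\mathcal X$. Its regret is $\mathrm{Reg}_T=\sum_{t=1}^T f_t(x_t)-\min_{x\in\mathcal X}\sum_{t=1}^T f_t(x)$. A function $f$ is $\lambda$-strongly convex on $\mathcal X$ if $f(y)\ge f(x)+\langle\nabla f(x),y-x\rangle+\frac\lambda2\|y-x\|^2$ for $x,y\in\mathcal X$, and $\alpha$-exp-concave if $\exp(-\alpha f)$ is concave on $\mathcal X$. **Algorithm.** Let $\mathcal Y=\{y:\|y\|\le D\}$, $N=\lceil\log_2T\rceil$ and $\mathcal P=\{2^k/T: 0\le k\le N\}$. The set $\mathcal A$ of experts consists of one convex expert, one exp-concave expert for each $\hat\alpha\in\mathcal P$ and one strongly convex expert for each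 $\hat\lambda\in\mathcal P$, so $|\mathcal A|=2N+3$. Expert $i$ starts at an arbitrary $y_1^i\in\mathcal Y$. In round $t$: * Put $y_t=\sum_i p_t^iy_t^i$ and submit $x_t=\Pi_{\mathcal X}[y_t]$, the Euclidean projection. Here $p_t^i=\eta_{t-1}^iw_{t-1}^i/\sum_j\eta_{t-1}^jw_{t-1}^j$ and $w_0^i=1/|\mathcal A|$. * Let $v_t=(y_t-x_t)/\|y_t-x_t\|$ (and $v_t=0$ if $y_t=x_t$), and let $h_t=\nabla f_t(x_t)-\mathbf 1_{\{\langle\nabla f_t(x_t),v_t\rangle<0\}}\langle\nabla f_t(x_t),v_t\rangle v_t$. This is a (sub)gradient at $y_t$ of the surrogate loss $g_t(y)=\langle\nabla f_t(x_t),y\rangle-\mathbf 1_{\{\langle\nabla f_t(x_t),v_t\rangle<0\}}\langle\nabla f_t(x_t),v_t\rangle\,\mathrm{dist}(y,\mathcal X)$. * (Adapt-ML-Prod) With $\ell_t^i=\frac{\langle h_t,y_t^i-y_t\rangle}{4GD}+\frac12$, $\ell_t=\sum_ip_t^i\ell_t^i$ and $\eta_t^i=\min\{\frac12,\sqrt{\ln|\mathcal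 A|/(1+\sum_{s\le t}(\ell_s-\ell_s^i)^2)}\}$, set $w_t^i=\big(w_{t-1}^i(1+\eta_{t-1}^i(\ell_t-\ell_t^i))\big)^{\eta_t^i/\eta_{t-1}^i}$. * (Convex expert, online gradient descent) $y_{t+1}^i=\Pi_{\mathcal Y}[y_t^i-\frac1{\sqrt t}h_t]$. * (Strongly convex expert with parameter $\hat\lambda$, online gradient descent) $y_{t+1}^i=\Pi_{\mathcal Y}[y_t^i-\frac1{\hat\lambda t}(h_t+\hat\lambda(y_t^i-x_t))]$. * (Exp-concave expert with parameter $\hat\alpha$, online Newton step) With $\hat\beta=\frac12\min\{\frac1{4GD},\hat\alpha\}$, $\Sigma_1=\frac1{\hat\beta^2D^2}I$ and $q_t=h_t+\hat\beta\langle h_t,y_t^i-y_t\rangle h_t$, set $\Sigma_{t+1}=\Sigma_t+q_tq_t^\top$ and $y_{t+1}^i=\arg\min_{y\in\mathcal Y}(y-z)^\top\Sigma_{t+1}(y-z)$, where $z=y_t^i-\frac1{\hat\beta}\Sigma_{t+1}^{-1}q_t$. **Theorem.** The algorithm makes exactly one projection onto $\mathcal X$ per round, and $x_t\in\mathcal X$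 for all $t\le T$. Moreover there is a constant $C$ depending only on $G$ and $D$ such that, for all choices above, the following hold simultaneously (the algorithm is the same in all three cases and knows neither $\alpha$ nor $\lambda$). 1. If all $f_t$ are convex, then, with $\Gamma=3\ln|\mathcal A|+\ln\big(1+\frac{|\mathcal A|}{2e}(1+\ln(T+1))\big)$, $$\mathrm{Reg}_T\le 4\Gamma GD\Big(2+\frac1{\sqrt{\ln|\mathcal A|}}\Big)+\Big(\frac{2\Gamma GD}{\sqrt{\ln|\mathcal A|}}+2D^2+G^2\Big)\sqrt T-\frac{G^2}2 ,$$ and $\mathrm{Reg}_T\le C\sqrt{T\ln\ln T}$ if $T\ge3$; that is, the regret is $O(\sqrt T)$ when the doubly logarithmic factor is treated as a constant. 2. If all $f_t$ are $\alpha$-exp-concave with $\alpha\in[1/T,1]$, then $\mathrm{Reg}_T\le C\,\frac d\alpha\ln T$. 3. If all $f_t$ are $\lambda$-strongly convex with $\lambda\in[1/T,1]$, then $\mathrm{Reg}_T\le C\,\frac1\lambda\ln T$. -/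

import Mathlib

noncomputable section

/-- Points and gradients live in `ℝ^d` with the Euclidean norm. -/
abbrev Vec (d : ℕ) : Type := EuclideanSpace ℝ (Fin d)

/-! ### Online learners that access the feasible domain through a projection oracle -/

/-- A computation over the reals that may query an oracle for the projection onto the
feasible domain. -/
inductive ProjProg (d : ℕ) (R : Type) : Type
  | done (r : R) : ProjProg d R
  | project (y : Vec d) (k : Vec d → ProjProg d R) : ProjProg d R

namespace ProjProg

/-- The result of a computation when the projection oracle is `P`. -/
def eval {d : ℕ} {R : Type} (P : Vec d → Vec d) : ProjProg d R → R
  | done r => r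
  | project y k => eval P (k (P y))

/-- The number of projections made by a computation when the projection oracle is `P`. -/
def calls {d : ℕ} {R : Type} (P : Vec d → Vec d) : ProjProg d R → ℕ
  | done _ => 0
  | project y k => calls P (k (P y)) + 1

end ProjProg

/-- A deterministic online learner. In each round it first computes, by `act`, the decision that
it submits (and an internal state), and then, by `update`, processes the gradient of the current
loss at that decision. The feasible domain is accessible only through the projection oracle and
the losses only through the gradient feedback. -/
structure Learner (d : ℕ) : Type 1 where
  State : Type
  init : State
  act : State → ProjProg d (State × Vec d)
  update : State → Vec d → ProjProg d State

namespace Learner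

variable {d : ℕ}

/-- The state of the learner before the round with index `t = 0, 1, 2, …`; the gradient of the
loss of that round is `grad t`. -/
def stateAt (L : Learner d) (P : Vec d → Vec d) (grad : ℕ → Vec d → Vec d) : ℕ → L.State
  | 0 => L.init
  | t + 1 =>
    let a := (L.act (stateAt L P grad t)).eval P
    (L.update a.1 (grad t a.2)).eval P

/-- The internal state together with the decision submitted in round `t`. -/
def acted (L : Learner d) (P : Vec d → Vec d) (grad : ℕ → Vec d → Vec d) (t : ℕ) :
    L.State × Vec d :=
  (L.act (L.stateAt P grad t)).eval P

/-- The decision submitted in round `t`. -/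
def decision (L : Learner d) (P : Vec d → Vec d) (grad : ℕ → Vec d → Vec d) (t : ℕ) : Vec d :=
  (L.acted P grad t).2

/-- The number of projections onto the feasible domain made in round `t`. -/
def projections (L : Learner d) (P : Vec d → Vec d) (grad : ℕ → Vec d → Vec d) (t : ℕ) : ℕ :=
  (L.act (L.stateAt P grad t)).calls P +
    (L.update (L.acted P grad t).1 (grad t (L.decision P grad t))).calls P

end Learner

/-- `P` is the Euclidean projection onto `X`. -/
def IsProjectionOnto {d : ℕ} (X : Set (Vec d)) (P : Vec d → Vec d) : Prop :=
  ∀ y, P y ∈ X ∧ ∀ z ∈ X, ‖y - P y‖ ≤ ‖y - z‖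

/-- `Reg_T ≤ B`: the cumulative loss of the decisions `x 0, …, x (T - 1)` exceeds that of every
fixed point of `X`, hence that of the best one, by at most `B`. -/
def RegretAtMost {d : ℕ} (X : Set (Vec d)) (T : ℕ) (f : ℕ → Vec d → ℝ) (x : ℕ → Vec d)
    (B : ℝ) : Prop :=
  ∀ u ∈ X, ∑ t ∈ Finset.range T, f t (x t) - ∑ t ∈ Finset.range T, f t u ≤ B

/-! ### Function classes -/

/-- `f`, with gradient `df`, is `lam`-strongly convex on `X`. -/
def IsStronglyConvexOn {d : ℕ} (X : Set (Vec d)) (lam : ℝ) (f : Vec d → ℝ)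
    (df : Vec d → Vec d) : Prop :=
  ∀ x ∈ X, ∀ y ∈ X, f x + inner ℝ (df x) (y - x) + lam / 2 * ‖y - x‖ ^ 2 ≤ f y

/-- `f` is `α`-exponentially concave on `X`. -/
def IsExpConcaveOn {d : ℕ} (X : Set (Vec d)) (α : ℝ) (f : Vec d → ℝ) : Prop :=
  ConcaveOn ℝ X fun x => Real.exp (-α * f x)

/-! ### The experts and their updates -/

/-- The gradient at `y` of the domain-converting surrogate loss
`z ↦ ⟨g, z⟩ - 1{⟨g, v⟩ < 0} ⟨g, v⟩ dist(z, X)`, where `x` is the projection of `y` onto `X`,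
`g` is the gradient of the loss at `x` and `v = (y - x) / ‖y - x‖` (with `v = 0` if `y = x`). -/
def surrogateGrad {d : ℕ} (g x y : Vec d) : Vec d :=
  let v : Vec d := ‖y - x‖⁻¹ • (y - x)
  if inner ℝ g v < 0 then g - inner ℝ g v • v else g

/-- The Euclidean projection onto the ball of radius `D` around the origin. -/
def projBall {d : ℕ} (D : ℝ) (y : Vec d) : Vec d :=
  if ‖y‖ ≤ D then y else (D / ‖y‖) • y

/-- The squared norm `zᵀ S z` given by a matrix `S`. -/
def matNormSq {d : ℕ} (S : Matrix (Fin d) (Fin d) ℝ) (z : Vec d) : ℝ :=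
  inner ℝ z (Matrix.toEuclideanLin S z)

/-- The projection onto the ball of radius `D` around the origin in the norm given by a (positive
definite) matrix `S`: the point of the ball closest to `y` in that norm. -/
def projBallMat {d : ℕ} (D : ℝ) (S : Matrix (Fin d) (Fin d) ℝ) (y : Vec d) : Vec d :=
  Classical.epsilon fun z =>
    z ∈ Metric.closedBall (0 : Vec d) D ∧
      ∀ z' ∈ Metric.closedBall (0 : Vec d) D, matNormSq S (z - y) ≤ matNormSq S (z' - y)

/-- The index set of the moduli `1/T, 2/T, 4/T, …, 2^N/T` with `N = ⌈log₂ T⌉`. -/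
abbrev Grid (T : ℕ) : Type := Fin (Nat.clog 2 T + 1)

/-- The modulus `2^k / T`. -/
def modulus (T : ℕ) (k : Grid T) : ℝ := 2 ^ (k : ℕ) / T

/-- The experts: one for general convex functions, one for each modulus of exponential concavity
and one for each modulus of strong convexity, in this order. -/
abbrev Expert (T : ℕ) : Type := Unit ⊕ Grid T ⊕ Grid T

/-- The number of experts. -/
def numExperts (T : ℕ) : ℕ := Fintype.card (Expert T)

/-- The parameter `min {1 / (4GD), α} / 2` of the loss of an expert for exp-concave functions. -/
def expBeta (G D α : ℝ) : ℝ := 1 / 2 * min (1 / (4 * G * D)) α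

/-- Online gradient descent for convex functions, round `t = 1, 2, …`; `yi` is the decision of the
expert and `h` the gradient of the surrogate loss. -/
def ogdConvexStep {d : ℕ} (D : ℝ) (t : ℕ) (h yi : Vec d) : Vec d :=
  projBall D (yi - (1 / √(t : ℝ)) • h)

/-- Online gradient descent for strongly convex functions, round `t = 1, 2, …`, with the loss
`z ↦ ⟨h, z - y⟩ + (lam / 2) ‖z - x‖ ^ 2`. -/
def ogdStrongStep {d : ℕ} (D lam : ℝ) (t : ℕ) (h x yi : Vec d) : Vec d :=
  projBall D (yi - (1 / (lam * t)) • (h + lam • (yi - x)))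

/-- The gradient at `yi` of the loss `z ↦ ⟨h, z - y⟩ + (β / 2) ⟨h, z - y⟩ ^ 2`. -/
def expLossGrad {d : ℕ} (β : ℝ) (h y yi : Vec d) : Vec d :=
  h + (β * inner ℝ h (yi - y)) • h

/-- The matrix update of the online Newton step. -/
def onsMatStep {d : ℕ} (β : ℝ) (h y yi : Vec d) (S : Matrix (Fin d) (Fin d) ℝ) :
    Matrix (Fin d) (Fin d) ℝ :=
  S + Matrix.vecMulVec (expLossGrad β h y yi).ofLp (expLossGrad β h y yi).ofLp

/-- The update of the decision in the online Newton step. -/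
def onsStep {d : ℕ} (D β : ℝ) (h y yi : Vec d) (S : Matrix (Fin d) (Fin d) ℝ) : Vec d :=
  projBallMat D (onsMatStep β h y yi S)
    (yi - (1 / β) • Matrix.toEuclideanLin (onsMatStep β h y yi S)⁻¹ (expLossGrad β h y yi))

/-! ### The universal algorithm -/

/-- The state of the universal algorithm. -/
structure UniState (d T : ℕ) : Type where
  /-- the current round, counted from `1` -/
  round : ℕ
  /-- the decisions of the experts -/
  expert : Expert T → Vec d
  /-- the matrices of the experts that run the online Newton step -/
  mat : Grid T → Matrix (Fin d) (Fin d) ℝ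
  /-- the unnormalized weights of the experts -/
  weight : Expert T → ℝ
  /-- the sums, over the past rounds, of the squared differences between the loss of the
  meta-algorithm and that of the expert -/
  sq : Expert T → ℝ
  /-- the aggregated decision of the current round -/
  agg : Vec d
  /-- the submitted decision of the current round -/
  played : Vec d

/-- The learning rate of Adapt-ML-Prod for an expert, from its sum of squares. -/
def metaRate (T : ℕ) (V : ℝ) : ℝ := min (1 / 2) √(Real.log (numExperts T) / (1 + V))

namespace UniState

variable {d T : ℕ}

/-- The probability that Adapt-ML-Prod gives to an expert. -/
def prob (s : UniState d T) (i : Expert T) : ℝ :=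
  metaRate T (s.sq i) * s.weight i / ∑ j, metaRate T (s.sq j) * s.weight j

/-- The weighted average of the decisions of the experts. -/
def aggregate (s : UniState d T) : Vec d := ∑ i, s.prob i • s.expert i

/-- The loss of an expert in the meta-algorithm, normalized to `[0, 1]`; `h` is the gradient of
the surrogate loss at the aggregated decision. -/
def metaLoss (G D : ℝ) (s : UniState d T) (h : Vec d) (i : Expert T) : ℝ :=
  inner ℝ h (s.expert i - s.agg) / (4 * G * D) + 1 / 2

/-- The loss of the meta-algorithm minus the loss of an expert. -/
def excess (G D : ℝ) (s : UniState d T) (h : Vec d) (i : Expert T) : ℝ :=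
  (∑ j, s.prob j * s.metaLoss G D h j) - s.metaLoss G D h i

/-- The end of a round: all experts and their weights are updated; `h` is the gradient of the
surrogate loss at the aggregated decision. -/
def next (G D : ℝ) (s : UniState d T) (h : Vec d) : UniState d T where
  round := s.round + 1
  expert := fun i =>
    match i with
    | Sum.inl _ => ogdConvexStep D s.round h (s.expert i)
    | Sum.inr (Sum.inl k) =>
      onsStep D (expBeta G D (modulus T k)) h s.agg (s.expert i) (s.mat k)
    | Sum.inr (Sum.inr k) => ogdStrongStep D (modulus T k) s.round h s.played (s.expert i)
  mat := fun k =>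
    onsMatStep (expBeta G D (modulus T k)) h s.agg (s.expert (Sum.inr (Sum.inl k))) (s.mat k)
  weight := fun i =>
    (s.weight i * (1 + metaRate T (s.sq i) * s.excess G D h i)) ^
      (metaRate T (s.sq i + s.excess G D h i ^ 2) / metaRate T (s.sq i))
  sq := fun i => s.sq i + s.excess G D h i ^ 2
  agg := s.agg
  played := s.played

end UniState

/-- The universal algorithm for `T` rounds, with gradient bound `G`, diameter bound `D` and
initial decisions `y₁` of the experts. -/
def universalAlgorithm {d : ℕ} (G D : ℝ) (T : ℕ) (y₁ : Expert T → Vec d) : Learner d where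
  State := UniState d T
  init :=
    { round := 1
      expert := y₁
      mat := fun k => (1 / (expBeta G D (modulus T k) ^ 2 * D ^ 2)) • 1
      weight := fun _ => 1 / numExperts T
      sq := fun _ => 0
      agg := 0
      played := 0 }
  act := fun s =>
    .project s.aggregate fun x => .done ({ s with agg := s.aggregate, played := x }, x)
  update := fun s g => .done (s.next G D (surrogateGrad g s.played s.agg))

/-- The quantity `Γ = 3 ln |A| + ln (1 + |A| / (2e) (1 + ln (T + 1))) = O(log log T)`, where `|A|`
is the number of experts. -/
def metaGamma (T : ℕ) : ℝ :=
  3 * Real.log (numExperts T) +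
    Real.log (1 + numExperts T / (2 * Real.exp 1) * (1 + Real.log (T + 1)))

end

/-!
Why the regret bounds hold. Let `x`, `a`, `h` be the decision, the aggregated decision and the
surrogate gradient of a round, and let `y` be the decision of an expert.

* The surrogate gradient satisfies `‖h‖ ≤ G`, `⟨∇f(x), x - u⟩ ≤ ⟨h, x - u⟩` for `u` in the domain, and
  `0 ≤ ⟨h, a - x⟩` (`norm_surrogateGrad_le`, `inner_le_inner_surrogateGrad`,
  `inner_surrogateGrad_sub_nonneg`). So the regret on the domain is controlled by
  `∑ ⟨h, a - u⟩ = ∑ ⟨h, a - y⟩ + ∑ ⟨h, y - u⟩`: the regret of the meta-algorithm with respect to an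
  expert plus the regret of that expert.
* Adapt-ML-Prod has the second-order bound `∑ r ≤ Γ (2 + √(1 + ∑ r²) / √(log |A|))` with
  `r = ⟨h, a - y⟩ / (4GD)` (`IsAdaptMLProd.sum_excess_le`). For convex losses `∑ r² ≤ T / 4`, and
  online gradient descent gives the rest (`sum_inner_ogdConvexStep_le`). For curved losses
  `√(∑ r²)` is replaced by a small multiple of `∑ ⟨h, a - y⟩²` plus a remainder of order `log |A|`
  over that multiple (`mul_metaGamma_mul_le`), and the curvature absorbs this sum of squares.
* For strongly convex losses (`sub_le_of_strongConvex`), the loss is strongly convex around `x` and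
  not around `a`, so `a - y` is split at `x`. The part `⟨h, a - x⟩` is nonnegative and bounded, and
  the regret inequality contains it with a negative sign, which pays for its square.
* For exp-concave losses (`IsExpConcaveOn.sub_le_inner_add_expLoss`), the quadratic loss given to the
  online Newton step is not exp-concave enough for the standard analysis with step size `1 / β`
  to close by itself: the quadratic term gained from the loss is smaller than the one required. The
  sharp logarithmic form of the curvature of `f` (`IsExpConcaveOn.mul_sub_le_log`) has room for this
  deficit and for the variance of the meta-algorithm; this is the two-variable inequality
  `half_log_le_of_abs_le`. The online Newton step itself is the usual potential argument, with
  `qᵀ Σ'⁻¹ q ≤ log det Σ' - log det Σ` and a bound on the eigenvalues of the last matrix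
  (`sum_inner_onsStep_le`).

Since the grid of moduli contains one within a factor of two of the unknown `α` or `lam`
(`exists_modulus_le`), and `Γ ≤ 5 log |A|` is of order `log log T`, all bounds follow from
elementary estimates of constants.
-/

open Finset

/-! ### Elementary inequalities -/

theorem log_one_add_le_cubic {x : ℝ} (hx : -(1 / 2) ≤ x) (hx' : x ≤ 1 / 2) :
    Real.log (1 + x) ≤ x - x ^ 2 / 2 + x ^ 3 / 3 := by
  set g : ℝ → ℝ := fun x => x - x ^ 2 / 2 + x ^ 3 / 3 - Real.log (1 + x) with hg
  have hder : ∀ z : ℝ, -1 < z → HasDerivAt g (z ^ 3 / (1 + z)) z := by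
    intro z hz
    have hz' : (1 + z) ≠ 0 := by linarith
    have h1 : HasDerivAt (fun x : ℝ => Real.log (1 + x)) (1 / (1 + z)) z :=
      ((hasDerivAt_id z).const_add 1).log hz'
    have h2 := (((hasDerivAt_id z).sub ((hasDerivAt_pow 2 z).div_const 2)).add
      ((hasDerivAt_pow 3 z).div_const 3)).sub h1
    refine h2.congr_deriv ?_
    field_simp
    norm_num
    ring
  have h0 : g 0 = 0 := by simp [hg]
  suffices 0 ≤ g x by simp only [hg] at this; linarith
  rcases le_total 0 x with h | h
  · have : MonotoneOn g (Set.Icc 0 (1 / 2)) := by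
      refine monotoneOn_of_deriv_nonneg (convex_Icc _ _) ?_ ?_ ?_
      · exact fun z hz => (hder z (by linarith [hz.1])).continuousAt.continuousWithinAt
      · intro z hz
        rw [interior_Icc] at hz
        exact (hder z (by linarith [hz.1])).differentiableAt.differentiableWithinAt
      · intro z hz
        rw [interior_Icc] at hz
        rw [(hder z (by linarith [hz.1])).deriv]
        have := hz.1
        positivity
    rw [← h0]
    exact this ⟨le_rfl, by norm_num⟩ ⟨h, hx'⟩ h
  · have : AntitoneOn g (Set.Icc (-(1 / 2)) 0) := by
      refine antitoneOn_of_deriv_nonpos (convex_Icc _ _) ?_ ?_ ?_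
      · exact fun z hz => (hder z (by linarith [hz.1])).continuousAt.continuousWithinAt
      · intro z hz
        rw [interior_Icc] at hz
        exact (hder z (by linarith [hz.1])).differentiableAt.differentiableWithinAt
      · intro z hz
        rw [interior_Icc] at hz
        rw [(hder z (by linarith [hz.1])).deriv]
        refine div_nonpos_of_nonpos_of_nonneg ?_ (by linarith [hz.1])
        have := hz.2
        nlinarith [sq_nonneg z]
    rw [← h0]
    exact this ⟨hx, h⟩ ⟨by norm_num, le_rfl⟩ h

/-- Per-round inequality behind the regret bound for exp-concave losses. Here `b` and `e` stand for
`β ⟨h, yᵢ - y⟩` and `β ⟨h, yᵢ - u⟩`: the left side bounds the regret of the round, and the right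
side is what the meta-algorithm and the online Newton step can pay for. -/
theorem half_log_le_of_abs_le {b e : ℝ} (he : |e| ≤ 1 / 4)
    (hbe : |e - b| ≤ 1 / 4) :
    1 / 2 * Real.log (1 + 2 * (e - b)) ≤
      -b - b ^ 2 / 16 + ((1 + b) * e - 1 / 2 * ((1 + b) * e) ^ 2) := by
  rw [abs_le] at he hbe
  have h1 := log_one_add_le_cubic (x := 2 * (e - b)) (by linarith) (by linarith)
  have h2 : (e - b) ^ 3 ≤ (e - b) ^ 2 / 4 := by nlinarith [sq_nonneg (e - b)]
  have h3 : b ^ 2 * e ^ 2 ≤ b ^ 2 / 16 := by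
    have : e ^ 2 ≤ 1 / 16 := by nlinarith
    nlinarith [sq_nonneg b]
  have h4 : b * e ^ 2 ≤ b * e / 4 ∨ b * e ^ 2 ≤ -(b * e) / 4 := by
    rcases le_total 0 b with h | h <;> rcases le_total 0 e with h' | h'
    · left; nlinarith [mul_nonneg h h']
    · right; nlinarith [mul_nonneg h (neg_nonneg.2 h')]
    · right; nlinarith [mul_nonneg (neg_nonneg.2 h) h', mul_nonneg (neg_nonneg.2 h) (sq_nonneg e)]
    · left; nlinarith [mul_nonneg (neg_nonneg.2 h) (neg_nonneg.2 h'),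
        mul_nonneg (neg_nonneg.2 h) (sq_nonneg e)]
  have h5 : 4 / 3 * (e - b) ^ 3 + b * e ^ 2 + b ^ 2 * e ^ 2 / 2 ≤
      15 / 16 * b ^ 2 - b * e + e ^ 2 / 2 := by
    rcases h4 with h4 | h4
    · nlinarith [sq_nonneg (e - 7 / 4 * b), sq_nonneg b]
    · nlinarith [sq_nonneg (e - 1 / 4 * b), sq_nonneg b]
  nlinarith

theorem sub_sq_le_log_one_add {x : ℝ} (hx : -(1 / 2) ≤ x) : x - x ^ 2 ≤ Real.log (1 + x) := by
  set g : ℝ → ℝ := fun x => Real.log (1 + x) - (x - x ^ 2) with hg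
  have hder : ∀ z : ℝ, -1 < z → HasDerivAt g (z * (1 + 2 * z) / (1 + z)) z := by
    intro z hz
    have hz' : (1 + z) ≠ 0 := by linarith
    have h1 : HasDerivAt (fun x : ℝ => Real.log (1 + x)) (1 / (1 + z)) z :=
      ((hasDerivAt_id z).const_add 1).log hz'
    have h2 := h1.sub ((hasDerivAt_id z).sub (hasDerivAt_pow 2 z))
    refine h2.congr_deriv ?_
    field_simp
    norm_num
    ring
  have h0 : g 0 = 0 := by simp [hg]
  suffices 0 ≤ g x by simp only [hg] at this; linarith
  rcases le_total 0 x with h | h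
  · have : MonotoneOn g (Set.Ici 0) := by
      refine monotoneOn_of_deriv_nonneg (convex_Ici _) ?_ ?_ ?_
      · exact fun z hz => (hder z (by linarith [Set.mem_Ici.1 hz])).continuousAt.continuousWithinAt
      · intro z hz
        rw [interior_Ici, Set.mem_Ioi] at hz
        exact (hder z (by linarith)).differentiableAt.differentiableWithinAt
      · intro z hz
        rw [interior_Ici, Set.mem_Ioi] at hz
        rw [(hder z (by linarith)).deriv]
        positivity
    rw [← h0]
    exact this (Set.mem_Ici.2 le_rfl) h h
  · have : AntitoneOn g (Set.Icc (-(1 / 2)) 0) := by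
      refine antitoneOn_of_deriv_nonpos (convex_Icc _ _) ?_ ?_ ?_
      · exact fun z hz => (hder z (by linarith [hz.1])).continuousAt.continuousWithinAt
      · intro z hz
        rw [interior_Icc] at hz
        exact (hder z (by linarith [hz.1])).differentiableAt.differentiableWithinAt
      · intro z hz
        rw [interior_Icc] at hz
        rw [(hder z (by linarith [hz.1])).deriv]
        refine div_nonpos_of_nonpos_of_nonneg ?_ (by linarith [hz.1])
        exact mul_nonpos_of_nonpos_of_nonneg hz.2.le (by linarith [hz.1])
    rw [← h0]
    exact this ⟨hx, h⟩ ⟨by norm_num, le_rfl⟩ h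

/-- The price of changing the exponent of a weight, uniform in the weight: `x (1 - x ^ (a - 1))` is at
most `(a - 1) (-x log x)`, and `-x log x ≤ 1 / e`. -/
theorem le_rpow_add_div_exp_one {x a : ℝ} (hx : 0 < x) (ha : 1 ≤ a) :
    x ≤ x ^ a + (a - 1) / Real.exp 1 := by
  -- with `x = exp l`, the claim is `exp l * (1 - exp ((a - 1) l)) ≤ (a - 1) / e`
  have h1 : x ^ a = x * Real.exp ((a - 1) * Real.log x) := by
    rw [mul_comm (a - 1), ← Real.rpow_def_of_pos hx, ← Real.rpow_one_add' hx.le (by linarith)]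
    congr 1; ring
  have h2 := Real.add_one_le_exp ((a - 1) * Real.log x)
  have h3 : -(x * Real.log x) ≤ 1 / Real.exp 1 := by
    have h := Real.add_one_le_exp (-Real.log x - 1)
    rw [Real.exp_sub, Real.exp_neg, Real.exp_log hx] at h
    have h' := mul_le_mul_of_nonneg_left h hx.le
    have : x * (x⁻¹ / Real.exp 1) = 1 / Real.exp 1 := by field_simp
    rw [this] at h'
    linarith
  have h4 : (a - 1) * -(x * Real.log x) ≤ (a - 1) * (1 / Real.exp 1) :=
    mul_le_mul_of_nonneg_left h3 (by linarith)
  have h5 := mul_le_mul_of_nonneg_left h2 hx.le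
  rw [h1, div_eq_mul_one_div]
  nlinarith

theorem div_sqrt_le_mul_sqrt_sub {A a : ℝ} (hA : 0 ≤ A) (ha : 0 ≤ a) (ha' : a ≤ 1 / 4) :
    a / √(1 + A) ≤ 3 * (√(1 + (A + a)) - √(1 + A)) := by
  set p := √(1 + A)
  set q := √(1 + (A + a))
  have hp : 1 ≤ p := Real.one_le_sqrt.2 (by linarith)
  have hp2 : p ^ 2 = 1 + A := Real.sq_sqrt (by linarith)
  have hq2 : q ^ 2 = 1 + (A + a) := Real.sq_sqrt (by linarith)
  have hq0 : 0 ≤ q := Real.sqrt_nonneg _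
  have hpq : p ≤ q := Real.sqrt_le_sqrt (by linarith)
  have hq : q ≤ 2 * p := by nlinarith
  have ha2 : a = (q - p) * (q + p) := by nlinarith
  rw [div_le_iff₀ (by linarith), ha2]
  nlinarith

/-- The right side is the increment of a potential, so that the sum over all rounds telescopes to
`log (1 + V)` with coefficient one. -/
theorem div_one_add_le_log_sub {A a : ℝ} (hA : 0 ≤ A) (ha : 0 ≤ a) (ha' : a ≤ 1 / 4) :
    a / (1 + A) ≤ (Real.log (1 + (A + a)) - 1 / 4 * (1 / (1 + (A + a)))) -
      (Real.log (1 + A) - 1 / 4 * (1 / (1 + A))) := by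
  have h1 : 0 < 1 + A := by linarith
  have h2 : 0 < 1 + (A + a) := by linarith
  have h3 : a / (1 + (A + a)) ≤ Real.log (1 + (A + a)) - Real.log (1 + A) := by
    have h := Real.one_sub_inv_le_log_of_pos (div_pos h2 h1)
    rw [Real.log_div h2.ne' h1.ne'] at h
    refine le_trans (le_of_eq ?_) h
    field_simp
    ring
  have h4 : a / (1 + A) - a / (1 + (A + a)) = a * (1 / (1 + A) - 1 / (1 + (A + a))) := by ring
  have h5 : 0 ≤ 1 / (1 + A) - 1 / (1 + (A + a)) :=
    sub_nonneg.2 (one_div_le_one_div_of_le h1 (by linarith))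
  nlinarith

theorem sqrt_one_add_sub_one_le {x : ℝ} (hx : 0 ≤ x) : √(1 + x) - 1 ≤ x / 2 := by
  have : √(1 + x) ≤ 1 + x / 2 := Real.sqrt_le_iff.2 ⟨by linarith, by nlinarith⟩
  linarith

/-- The right side is the integral of `1 / √s` over `[n, n + 1]`. -/
theorem one_div_sqrt_le (n : ℕ) : 1 / √((n + 1 : ℕ) : ℝ) ≤ 2 * (√((n + 1 : ℕ) : ℝ) - √(n : ℝ)) := by
  set p := √(n : ℝ)
  set q := √((n + 1 : ℕ) : ℝ)
  have hp2 : p ^ 2 = n := Real.sq_sqrt (by positivity)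
  have hq2 : q ^ 2 = n + 1 := by rw [Real.sq_sqrt (by positivity)]; push_cast; ring
  have hp : 0 ≤ p := Real.sqrt_nonneg _
  have hq : 0 < q := Real.sqrt_pos.2 (by positivity)
  have hpq : p ≤ q := Real.sqrt_le_sqrt (by push_cast; linarith)
  rw [div_le_iff₀ hq]
  nlinarith [sq_nonneg (q - p)]

theorem sum_one_div_succ_le (n : ℕ) :
    ∑ t ∈ range n, 1 / ((t + 1 : ℕ) : ℝ) ≤ 1 + Real.log n := by
  have h := harmonic_le_one_add_log n
  rw [harmonic_eq_sum_Icc] at h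
  push_cast at h
  rw [range_eq_Ico, sum_Ico_add' (fun t : ℕ => 1 / (t : ℝ)) 0 n 1, zero_add]
  simpa [one_div, ← Finset.Ico_succ_right_eq_Icc] using h

/-! ### The number of experts and the logarithmic factors -/

theorem numExperts_eq (T : ℕ) : numExperts T = 2 * Nat.clog 2 T + 3 := by
  simp [numExperts, Expert]
  omega

theorem five_le_numExperts {T : ℕ} (hT : 2 ≤ T) : 5 ≤ numExperts T := by
  have : 0 < Nat.clog 2 T := Nat.clog_pos one_lt_two hT
  rw [numExperts_eq]; omega

theorem one_le_log_numExperts {T : ℕ} (hT : 2 ≤ T) : 1 ≤ Real.log (numExperts T) := by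
  have h5 : (5 : ℝ) ≤ numExperts T := by exact_mod_cast five_le_numExperts hT
  rw [Real.le_log_iff_exp_le (by linarith)]
  linarith [Real.exp_one_lt_d9]

theorem half_le_log {T : ℕ} (hT : 2 ≤ T) : 1 / 2 ≤ Real.log T := by
  have h1 : Real.log 2 ≤ Real.log T := Real.log_le_log (by norm_num) (by exact_mod_cast hT)
  linarith [Real.log_two_gt_d9]

theorem numExperts_le_log {T : ℕ} (hT : 2 ≤ T) : (numExperts T : ℝ) ≤ 14 * Real.log T := by
  have hT0 : (0 : ℝ) < T := by positivity
  -- `2 ^ (N - 1) < T`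
  have h1 : 2 ^ (Nat.clog 2 T - 1) < T := Nat.pow_pred_clog_lt_self one_lt_two hT
  have h2 : ((Nat.clog 2 T - 1 : ℕ) : ℝ) * Real.log 2 ≤ Real.log T := by
    rw [← Real.log_pow]
    exact Real.log_le_log (by positivity) (by exact_mod_cast h1.le)
  have h3 : (Nat.clog 2 T : ℝ) ≤ ((Nat.clog 2 T - 1 : ℕ) : ℝ) + 1 := by
    have : Nat.clog 2 T ≤ Nat.clog 2 T - 1 + 1 := by omega
    exact_mod_cast this
  have h4 := half_le_log hT
  have h5 : ((Nat.clog 2 T - 1 : ℕ) : ℝ) ≤ 2 * Real.log T := by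
    have : (0 : ℝ) ≤ ((Nat.clog 2 T - 1 : ℕ) : ℝ) := by positivity
    nlinarith [Real.log_two_gt_d9]
  rw [numExperts_eq]
  push_cast
  linarith

theorem log_numExperts_le {T : ℕ} (hT : 2 ≤ T) :
    Real.log (numExperts T) ≤ 14 * Real.log T := by
  have h5 : (5 : ℝ) ≤ numExperts T := by exact_mod_cast five_le_numExperts hT
  have := Real.log_le_sub_one_of_pos (x := (numExperts T : ℝ)) (by linarith)
  linarith [numExperts_le_log hT]

theorem metaGamma_le {T : ℕ} (hT : 2 ≤ T) : metaGamma T ≤ 5 * Real.log (numExperts T) := by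
  set K : ℝ := (numExperts T : ℝ) with hK
  have h5 : (5 : ℝ) ≤ K := by rw [hK]; exact_mod_cast five_le_numExperts hT
  have h1 : Real.log (T + 1) ≤ Nat.clog 2 T + 1 := by
    have hp : T + 1 ≤ 2 ^ (Nat.clog 2 T + 1) := by
      have := Nat.le_pow_clog one_lt_two T
      rw [pow_succ]; omega
    have : Real.log (T + 1) ≤ Real.log (2 ^ (Nat.clog 2 T + 1)) :=
      Real.log_le_log (by positivity) (by exact_mod_cast hp)
    rw [Real.log_pow] at this
    push_cast at this
    have h0 : (0 : ℝ) ≤ Nat.clog 2 T := by positivity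
    nlinarith [Real.log_two_lt_d9]
  have h2 : 1 + Real.log (T + 1) ≤ K := by
    rw [hK, numExperts_eq]; push_cast
    have h0 : (0 : ℝ) ≤ Nat.clog 2 T := by positivity
    linarith
  have h3 : 0 ≤ Real.log ((T : ℝ) + 1) := Real.log_nonneg (by linarith [Nat.cast_nonneg (α := ℝ) T])
  have he : 1 ≤ Real.exp 1 := Real.one_le_exp (by norm_num)
  have h4 : K / (2 * Real.exp 1) * (1 + Real.log (T + 1)) ≤ K / 2 * K := by
    have : K / (2 * Real.exp 1) ≤ K / 2 :=
      div_le_div_of_nonneg_left (by linarith) (by norm_num) (by linarith)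
    exact mul_le_mul this h2 (by linarith) (by linarith)
  have h6 : 0 ≤ K / (2 * Real.exp 1) * (1 + Real.log (T + 1)) := by positivity
  have h7 : Real.log (1 + K / (2 * Real.exp 1) * (1 + Real.log (T + 1))) ≤ Real.log (K ^ 2) :=
    Real.log_le_log (by linarith) (by nlinarith)
  rw [Real.log_pow] at h7
  push_cast at h7
  simp only [metaGamma, ← hK]
  linarith

theorem metaGamma_nonneg {T : ℕ} (hT : 2 ≤ T) : 0 ≤ metaGamma T := by
  have h1 := one_le_log_numExperts hT
  have h3 : 0 ≤ Real.log ((T : ℝ) + 1) := Real.log_nonneg (by linarith [Nat.cast_nonneg (α := ℝ) T])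
  have h2 : 0 ≤ Real.log (1 + numExperts T / (2 * Real.exp 1) * (1 + Real.log (T + 1))) :=
    Real.log_nonneg (by
      have : 0 ≤ (numExperts T : ℝ) / (2 * Real.exp 1) * (1 + Real.log (T + 1)) := by positivity
      linarith)
  unfold metaGamma
  linarith

/-- Every parameter in `[1/T, 1]` is matched, up to a factor of two, by a modulus of the grid. -/
theorem exists_modulus_le {T : ℕ} (hT : 2 ≤ T) {a : ℝ} (ha : 1 / (T : ℝ) ≤ a) (ha' : a ≤ 1) :
    ∃ k : Grid T, 0 < modulus T k ∧ modulus T k ≤ a ∧ a ≤ 2 * modulus T k := by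
  have hT0 : (0 : ℝ) < T := by positivity
  have h1 : 1 ≤ a * T := by rwa [div_le_iff₀ hT0] at ha
  obtain ⟨n, hn, hn'⟩ := exists_nat_pow_near h1 one_lt_two
  have hle : n ≤ Nat.clog 2 T := by
    have h2 : (2 : ℝ) ^ n ≤ T := hn.trans (by nlinarith)
    have h3 : 2 ^ n ≤ T := by exact_mod_cast h2
    exact (Nat.pow_le_pow_iff_right one_lt_two).1 (h3.trans (Nat.le_pow_clog one_lt_two T))
  refine ⟨⟨n, by omega⟩, ?_, ?_, ?_⟩ <;> simp only [modulus]
  · positivity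
  · rwa [div_le_iff₀ hT0]
  · rw [mul_div_assoc', le_div_iff₀ hT0, ← pow_succ']
    exact hn'.le

/-! ### The second-order regret bound of Adapt-ML-Prod -/

theorem metaRate_pos {T : ℕ} (hT : 2 ≤ T) {V : ℝ} (hV : 0 ≤ V) : 0 < metaRate T V := by
  have := one_le_log_numExperts hT
  exact lt_min (by norm_num) (Real.sqrt_pos.2 (by positivity))

theorem metaRate_le_half (T : ℕ) (V : ℝ) : metaRate T V ≤ 1 / 2 := min_le_left _ _

theorem metaRate_zero {T : ℕ} (hT : 2 ≤ T) : metaRate T 0 = 1 / 2 := by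
  refine min_eq_left (Real.le_sqrt_of_sq_le ?_)
  linarith [one_le_log_numExperts hT]

theorem metaRate_le_sqrt_div (T : ℕ) {V : ℝ} :
    metaRate T V ≤ √(Real.log (numExperts T)) / √(1 + V) := by
  refine (min_le_right _ _).trans (le_of_eq ?_)
  rw [Real.sqrt_div (Real.log_natCast_nonneg _)]

theorem one_div_metaRate_le {T : ℕ} (hT : 2 ≤ T) {V : ℝ} (hV : 0 ≤ V) :
    1 / metaRate T V ≤ 2 + √(1 + V) / √(Real.log (numExperts T)) := by
  have hL := one_le_log_numExperts hT
  have h0 : 0 ≤ √(1 + V) / √(Real.log (numExperts T)) := by positivity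
  rcases min_choice (1 / 2) √(Real.log (numExperts T) / (1 + V)) with h | h
  · rw [metaRate, h]; norm_num; exact h0
  · rw [metaRate, h, Real.sqrt_div (by linarith), one_div_div]
    linarith

theorem metaRate_div_metaRate_sub_one_le {T : ℕ} (hT : 2 ≤ T) {V a : ℝ} (hV : 0 ≤ V) (ha : 0 ≤ a) :
    metaRate T V / metaRate T (V + a) - 1 ≤ 1 / 2 * (a / (1 + V)) := by
  have hL := one_le_log_numExperts hT
  have hpos := metaRate_pos hT (add_nonneg hV ha)
  set ρ := √(1 + a / (1 + V)) with hρ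
  have hρ1 : 1 ≤ ρ := Real.one_le_sqrt.2 (by
    have : 0 ≤ a / (1 + V) := by positivity
    linarith)
  have hrate : √(Real.log (numExperts T) / (1 + V)) =
      ρ * √(Real.log (numExperts T) / (1 + (V + a))) := by
    rw [hρ, ← Real.sqrt_mul (by positivity)]
    congr 1
    field_simp
    ring
  have h1 : metaRate T V ≤ ρ * metaRate T (V + a) := by
    unfold metaRate
    rw [mul_min_of_nonneg _ _ (by linarith), hrate]
    exact min_le_min_right _ (by linarith)
  have h2 : metaRate T V / metaRate T (V + a) ≤ ρ := (div_le_iff₀ hpos).2 h1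
  have h3 := sqrt_one_add_sub_one_le (x := a / (1 + V)) (by positivity)
  linarith

/-- A run of Adapt-ML-Prod for `T` rounds, as seen from the outside: `w t i` are the weights, `r t i`
is the loss of the meta-algorithm minus that of expert `i`, and `V t i` is the sum of `r s i ^ 2`
over the rounds `s < t`. -/
structure IsAdaptMLProd (T : ℕ) (w V r : ℕ → Expert T → ℝ) : Prop where
  weight_zero : ∀ i, w 0 i = 1 / numExperts T
  sq_zero : ∀ i, V 0 i = 0
  weight_succ : ∀ t < T, ∀ i, w (t + 1) i =
    (w t i * (1 + metaRate T (V t i) * r t i)) ^ (metaRate T (V (t + 1) i) / metaRate T (V t i))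
  sq_succ : ∀ t < T, ∀ i, V (t + 1) i = V t i + r t i ^ 2
  abs_excess_le : ∀ t < T, ∀ i, |r t i| ≤ 1 / 2
  sum_excess : ∀ t < T, ∑ i, metaRate T (V t i) * w t i * r t i = 0

namespace IsAdaptMLProd

variable {T : ℕ} {w V r : ℕ → Expert T → ℝ}

theorem excess_sq_le (H : IsAdaptMLProd T w V r) {t : ℕ} (ht : t < T) (i : Expert T) :
    r t i ^ 2 ≤ 1 / 4 := by
  have := abs_le.1 (H.abs_excess_le t ht i)
  nlinarith

theorem sq_nonneg (H : IsAdaptMLProd T w V r) (i : Expert T) :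
    ∀ t ≤ T, 0 ≤ V t i := by
  intro t
  induction t with
  | zero => intro _; rw [H.sq_zero]
  | succ t ih =>
    intro ht
    rw [H.sq_succ t ht]
    have := ih (by omega)
    positivity

theorem sq_le (H : IsAdaptMLProd T w V r) (i : Expert T) :
    ∀ t ≤ T, V t i ≤ t / 4 := by
  intro t
  induction t with
  | zero => intro _; rw [H.sq_zero]; simp
  | succ t ih =>
    intro ht
    rw [H.sq_succ t ht]
    have := ih (by omega)
    have := H.excess_sq_le ht i
    push_cast
    linarith

theorem neg_half_le_rate_mul_excess (H : IsAdaptMLProd T w V r) (hT : 2 ≤ T) {t : ℕ} (ht : t < T)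
    (i : Expert T) : -(1 / 2) ≤ metaRate T (V t i) * r t i := by
  have h1 := metaRate_pos hT (H.sq_nonneg i t ht.le)
  have h2 := metaRate_le_half T (V t i)
  have h3 := abs_le.1 (H.abs_excess_le t ht i)
  nlinarith

theorem weight_pos (H : IsAdaptMLProd T w V r) (hT : 2 ≤ T) (i : Expert T) :
    ∀ t ≤ T, 0 < w t i := by
  intro t
  induction t with
  | zero =>
    intro _
    rw [H.weight_zero]
    have : 0 < numExperts T := by linarith [five_le_numExperts hT]
    positivity
  | succ t ih =>
    intro ht
    rw [H.weight_succ t ht]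
    have := H.neg_half_le_rate_mul_excess hT ht i
    exact Real.rpow_pos_of_pos (mul_pos (ih (by omega)) (by linarith)) _

/-- The terms linear in the excess cancel by the choice of the probabilities, so the total weight
grows only through the change of the learning rates. -/
theorem sum_weight_succ_le (H : IsAdaptMLProd T w V r) (hT : 2 ≤ T) {t : ℕ} (ht : t < T) :
    ∑ i, w (t + 1) i ≤ ∑ i, w t i + 1 / (2 * Real.exp 1) *
      ∑ i, ((Real.log (1 + V (t + 1) i) - 1 / 4 * (1 / (1 + V (t + 1) i))) -
        (Real.log (1 + V t i) - 1 / 4 * (1 / (1 + V t i)))) := by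
  have hterm : ∀ i, w (t + 1) i ≤ (w t i + metaRate T (V t i) * w t i * r t i) +
      1 / (2 * Real.exp 1) * ((Real.log (1 + V (t + 1) i) - 1 / 4 * (1 / (1 + V (t + 1) i))) -
        (Real.log (1 + V t i) - 1 / 4 * (1 / (1 + V t i)))) := by
    intro i
    have hV := H.sq_nonneg i t ht.le
    have hη := metaRate_pos hT hV
    have hη' := metaRate_pos hT (H.sq_nonneg i (t + 1) ht)
    have hw := H.weight_pos hT i t ht.le
    have hx := H.neg_half_le_rate_mul_excess hT ht i
    have ha : 1 ≤ metaRate T (V t i) / metaRate T (V (t + 1) i) := by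
      rw [one_le_div hη']
      refine min_le_min_left _ (Real.sqrt_le_sqrt ?_)
      refine div_le_div_of_nonneg_left (by linarith [one_le_log_numExperts hT]) (by linarith) ?_
      rw [H.sq_succ t ht]
      linarith [_root_.sq_nonneg (r t i)]
    have h1 := le_rpow_add_div_exp_one (H.weight_pos hT i (t + 1) ht) ha
    have h2 : w (t + 1) i ^ (metaRate T (V t i) / metaRate T (V (t + 1) i)) =
        w t i + metaRate T (V t i) * w t i * r t i := by
      rw [H.weight_succ t ht, ← Real.rpow_mul (mul_nonneg hw.le (by linarith)),
        div_mul_div_cancel₀ hη.ne', div_self hη'.ne', Real.rpow_one]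
      ring
    have h3 := metaRate_div_metaRate_sub_one_le hT hV (_root_.sq_nonneg (r t i))
    have h4 := div_one_add_le_log_sub hV (_root_.sq_nonneg (r t i)) (H.excess_sq_le ht i)
    rw [← H.sq_succ t ht] at h3 h4
    rw [h2] at h1
    refine h1.trans (add_le_add_right ?_ _)
    rw [div_le_iff₀ (Real.exp_pos 1)]
    refine h3.trans ?_
    rw [mul_right_comm, show 1 / (2 * Real.exp 1) * Real.exp 1 = 1 / 2 by field_simp]
    exact mul_le_mul_of_nonneg_left h4 (by norm_num)
  refine (sum_le_sum fun i _ => hterm i).trans (le_of_eq ?_)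
  rw [sum_add_distrib, sum_add_distrib, H.sum_excess t ht, add_zero, mul_sum]

theorem sum_weight_le (H : IsAdaptMLProd T w V r) (hT : 2 ≤ T) :
    ∑ i, w T i ≤ 1 + numExperts T / (2 * Real.exp 1) * (1 + Real.log (T + 1)) := by
  have key : ∀ t ≤ T, ∑ i, w t i ≤ 1 + 1 / (2 * Real.exp 1) *
      ∑ i, ((Real.log (1 + V t i) - 1 / 4 * (1 / (1 + V t i))) + 1 / 4) := by
    intro t
    induction t with
    | zero =>
      intro _
      have hK : (numExperts T : ℝ) ≠ 0 := by
        have := five_le_numExperts hT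
        positivity
      simp only [H.weight_zero, H.sq_zero, sum_const, card_univ, nsmul_eq_mul]
      rw [show Fintype.card (Expert T) = numExperts T from rfl, mul_one_div_cancel hK]
      simp
    | succ t ih =>
      intro ht
      have h1 := H.sum_weight_succ_le hT ht
      have h2 := ih (by omega)
      refine (h1.trans (add_le_add_left h2 _)).trans (le_of_eq ?_)
      rw [add_assoc, ← mul_add, ← sum_add_distrib]
      congr 2
      refine sum_congr rfl fun i _ => ?_
      ring
  refine (key T le_rfl).trans (add_le_add_right ?_ _)
  have hterm : ∀ i, (Real.log (1 + V T i) - 1 / 4 * (1 / (1 + V T i))) + 1 / 4 ≤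
      1 + Real.log (T + 1) := by
    intro i
    have h0 := H.sq_nonneg i T le_rfl
    have h1 := H.sq_le i T le_rfl
    have h2 : Real.log (1 + V T i) ≤ Real.log (T + 1) :=
      Real.log_le_log (by linarith) (by linarith [Nat.cast_nonneg (α := ℝ) T])
    have h3 : 0 ≤ 1 / (1 + V T i) := by positivity
    linarith
  have h := sum_le_sum fun i (_ : i ∈ univ) => hterm i
  rw [sum_const, card_univ, nsmul_eq_mul] at h
  refine (mul_le_mul_of_nonneg_left h (by positivity)).trans (le_of_eq ?_)
  rw [show Fintype.card (Expert T) = numExperts T from rfl]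
  ring

/-- The weight of expert `i` after `t` rounds is bounded below in terms of its cumulative excess. -/
theorem sum_excess_le_log_weight (H : IsAdaptMLProd T w V r) (hT : 2 ≤ T) (i : Expert T) :
    ∀ t ≤ T, ∑ s ∈ range t, r s i ≤ 2 * Real.log (numExperts T) +
      3 * √(Real.log (numExperts T)) * (√(1 + V t i) - 1) +
      Real.log (w t i) / metaRate T (V t i) := by
  intro t
  induction t with
  | zero =>
    intro _
    rw [H.weight_zero, H.sq_zero, metaRate_zero hT, one_div, Real.log_inv]
    simp
    linarith
  | succ t ih =>
    intro ht
    have hV := H.sq_nonneg i t (by omega)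
    have hη := metaRate_pos hT hV
    have hη' := metaRate_pos hT (H.sq_nonneg i (t + 1) ht)
    have hw := H.weight_pos hT i t (by omega)
    have hx := H.neg_half_le_rate_mul_excess hT ht i
    have h1 : Real.log (w (t + 1) i) / metaRate T (V (t + 1) i) =
        Real.log (w t i) / metaRate T (V t i) +
          Real.log (1 + metaRate T (V t i) * r t i) / metaRate T (V t i) := by
      rw [H.weight_succ t ht, Real.log_rpow (mul_pos hw (by linarith)),
        Real.log_mul hw.ne' (by linarith)]
      field_simp
    have h2 : r t i - metaRate T (V t i) * r t i ^ 2 ≤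
        Real.log (1 + metaRate T (V t i) * r t i) / metaRate T (V t i) := by
      rw [le_div_iff₀ hη]
      refine le_trans (le_of_eq ?_) (sub_sq_le_log_one_add hx)
      ring
    have h3 : metaRate T (V t i) * r t i ^ 2 ≤ 3 * √(Real.log (numExperts T)) *
        (√(1 + V (t + 1) i) - √(1 + V t i)) := by
      have h4 := div_sqrt_le_mul_sqrt_sub hV (_root_.sq_nonneg (r t i)) (H.excess_sq_le ht i)
      rw [← H.sq_succ t ht] at h4
      calc metaRate T (V t i) * r t i ^ 2
          ≤ √(Real.log (numExperts T)) / √(1 + V t i) * r t i ^ 2 :=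
            mul_le_mul_of_nonneg_right (metaRate_le_sqrt_div T) (_root_.sq_nonneg _)
        _ = √(Real.log (numExperts T)) * (r t i ^ 2 / √(1 + V t i)) := by ring
        _ ≤ √(Real.log (numExperts T)) * (3 * (√(1 + V (t + 1) i) - √(1 + V t i))) :=
            mul_le_mul_of_nonneg_left h4 (Real.sqrt_nonneg _)
        _ = _ := by ring
    rw [sum_range_succ, h1]
    linarith [ih (by omega)]

/-- The regret of Adapt-ML-Prod with respect to a fixed expert. The total weight stays of order
`|A| log T` although the exponents in the weight update vary, while the weight of the expert is at
least exponential in its excess. -/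
theorem sum_excess_le (H : IsAdaptMLProd T w V r) (hT : 2 ≤ T) (i : Expert T) :
    ∑ t ∈ range T, r t i ≤
      metaGamma T * (2 + √(1 + V T i) / √(Real.log (numExperts T))) := by
  have hL := one_le_log_numExperts hT
  have hV := H.sq_nonneg i T le_rfl
  have hη := metaRate_pos hT hV
  have h1 := H.sum_excess_le_log_weight hT i T le_rfl
  set B := Real.log (1 + numExperts T / (2 * Real.exp 1) * (1 + Real.log (T + 1))) with hB
  have hT0 : 0 ≤ Real.log ((T : ℝ) + 1) :=
    Real.log_nonneg (by linarith [Nat.cast_nonneg (α := ℝ) T])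
  have hB0 : 0 ≤ B := Real.log_nonneg (by
    have : 0 ≤ (numExperts T : ℝ) / (2 * Real.exp 1) * (1 + Real.log (T + 1)) := by positivity
    linarith)
  have h2 : Real.log (w T i) ≤ B := by
    refine Real.log_le_log (H.weight_pos hT i T le_rfl) (le_trans ?_ (H.sum_weight_le hT))
    exact single_le_sum (fun j _ => (H.weight_pos hT j T le_rfl).le) (mem_univ i)
  set q := √(1 + V T i) / √(Real.log (numExperts T)) with hq
  have hq0 : 0 ≤ q := by positivity
  have h3 : Real.log (w T i) / metaRate T (V T i) ≤ B * (2 + q) := by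
    rw [div_eq_mul_one_div]
    exact (mul_le_mul_of_nonneg_right h2 (by positivity)).trans
      (mul_le_mul_of_nonneg_left (one_div_metaRate_le hT hV) hB0)
  have h4 : √(Real.log (numExperts T)) * √(1 + V T i) = Real.log (numExperts T) * q := by
    have hs : 0 < √(Real.log (numExperts T)) := Real.sqrt_pos.2 (by linarith)
    rw [hq]
    nth_rewrite 2 [← Real.mul_self_sqrt (show 0 ≤ Real.log (numExperts T) by linarith)]
    field_simp
  have h5 : 0 ≤ √(Real.log (numExperts T)) := Real.sqrt_nonneg _
  have h6 : metaGamma T = 3 * Real.log (numExperts T) + B := rfl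
  rw [h6]
  linarith

end IsAdaptMLProd

/-! ### Online gradient descent -/

theorem norm_projBall_le {d : ℕ} {D : ℝ} (hD : 0 ≤ D) (y : Vec d) : ‖projBall D y‖ ≤ D := by
  unfold projBall
  split_ifs with h
  · exact h
  · push Not at h
    have hy : 0 < ‖y‖ := hD.trans_lt h
    rw [norm_smul, Real.norm_of_nonneg (by positivity), div_mul_cancel₀ _ hy.ne']

theorem norm_projBall_sub_sq_le {d : ℕ} {D : ℝ} (hD : 0 ≤ D) (y : Vec d) {u : Vec d}
    (hu : ‖u‖ ≤ D) : ‖projBall D y - u‖ ^ 2 ≤ ‖y - u‖ ^ 2 := by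
  unfold projBall
  split_ifs with h
  · exact le_rfl
  · push Not at h
    have hy : 0 < ‖y‖ := hD.trans_lt h
    set c := D / ‖y‖ with hc
    have hc0 : 0 ≤ c := by positivity
    have hc1 : c ≤ 1 := (div_le_one hy).2 h.le
    have hcy : c * ‖y‖ = D := div_mul_cancel₀ _ hy.ne'
    have hin : inner ℝ y u ≤ c * ‖y‖ ^ 2 := by
      have := real_inner_le_norm y u
      nlinarith
    rw [norm_sub_sq_real, norm_sub_sq_real, real_inner_smul_left, norm_smul,
      Real.norm_of_nonneg hc0]
    nlinarith [mul_le_mul_of_nonneg_left hin (sub_nonneg.2 hc1),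
      mul_nonneg (sq_nonneg (1 - c)) (sq_nonneg ‖y‖)]

theorem norm_projBall_sub_smul_sub_sq_le {d : ℕ} {D : ℝ} (hD : 0 ≤ D) (c : ℝ) (q y : Vec d)
    {u : Vec d} (hu : ‖u‖ ≤ D) : ‖projBall D (y - c • q) - u‖ ^ 2 ≤
      ‖y - u‖ ^ 2 - 2 * c * inner ℝ q (y - u) + c ^ 2 * ‖q‖ ^ 2 := by
  refine (norm_projBall_sub_sq_le hD _ hu).trans (le_of_eq ?_)
  rw [sub_right_comm, norm_sub_sq_real, real_inner_smul_right, norm_smul, mul_pow,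
    Real.norm_eq_abs, sq_abs, real_inner_comm]
  ring

theorem norm_sub_sq_le_four_mul_sq {d : ℕ} {D : ℝ} {y u : Vec d} (hy : ‖y‖ ≤ D) (hu : ‖u‖ ≤ D) :
    ‖y - u‖ ^ 2 ≤ 4 * D ^ 2 := by
  have := norm_sub_le y u
  have := norm_nonneg (y - u)
  nlinarith

/-- The regret of online gradient descent with step size `1 / √t` on a ball of diameter `2 D`. -/
theorem sum_inner_ogdConvexStep_le {d : ℕ} {D G : ℝ} (hD : 0 ≤ D) {T : ℕ} (hT : 1 ≤ T)
    {y h : ℕ → Vec d} {u : Vec d} (hu : ‖u‖ ≤ D) (hy : ∀ t ≤ T, ‖y t‖ ≤ D)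
    (hh : ∀ t < T, ‖h t‖ ≤ G)
    (hstep : ∀ t < T, y (t + 1) = ogdConvexStep D (t + 1) (h t) (y t)) :
    ∑ t ∈ range T, inner ℝ (h t) (y t - u) ≤ 2 * D ^ 2 * √(T : ℝ) + G ^ 2 * √(T : ℝ) - G ^ 2 / 2 := by
  have hround : ∀ t < T, inner ℝ (h t) (y t - u) ≤ √((t + 1 : ℕ) : ℝ) / 2 * ‖y t - u‖ ^ 2 -
      √((t + 1 : ℕ) : ℝ) / 2 * ‖y (t + 1) - u‖ ^ 2 + G ^ 2 / 2 * (1 / √((t + 1 : ℕ) : ℝ)) := by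
    intro t ht
    have h1 := norm_projBall_sub_smul_sub_sq_le hD (1 / √((t + 1 : ℕ) : ℝ)) (h t) (y t) hu
    rw [show projBall D (y t - (1 / √((t + 1 : ℕ) : ℝ)) • h t) = y (t + 1) from
      (hstep t ht).symm] at h1
    have hs : 0 < √((t + 1 : ℕ) : ℝ) := Real.sqrt_pos.2 (by positivity)
    set s := √((t + 1 : ℕ) : ℝ)
    have h2 : ‖h t‖ ^ 2 ≤ G ^ 2 := pow_le_pow_left₀ (norm_nonneg _) (hh t ht) 2
    have h3 : s / 2 * ‖y (t + 1) - u‖ ^ 2 ≤ s / 2 * ‖y t - u‖ ^ 2 - inner ℝ (h t) (y t - u) +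
        ‖h t‖ ^ 2 / 2 * (1 / s) := by
      refine (mul_le_mul_of_nonneg_left h1 (by positivity)).trans (le_of_eq ?_)
      field_simp
    have h4 := mul_le_mul_of_nonneg_right h2 (show 0 ≤ 1 / s by positivity)
    linarith
  have key : ∀ n, 1 ≤ n → n ≤ T →
      ∑ t ∈ range n, inner ℝ (h t) (y t - u) + √(n : ℝ) / 2 * ‖y n - u‖ ^ 2 ≤
        2 * D ^ 2 * √(n : ℝ) + G ^ 2 * √(n : ℝ) - G ^ 2 / 2 := by
    intro n hn
    induction n, hn using Nat.le_induction with
    | base =>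
      intro h1
      have h2 := hround 0 h1
      have h3 := norm_sub_sq_le_four_mul_sq (hy 0 (by omega)) hu
      simp at h2 ⊢
      linarith
    | succ n hn ih =>
      intro hnT
      have h1 := hround n hnT
      have h2 := ih (by omega)
      have h3 := norm_sub_sq_le_four_mul_sq (hy n (by omega)) hu
      have h4 := one_div_sqrt_le n
      have h5 : √(n : ℝ) ≤ √((n + 1 : ℕ) : ℝ) := Real.sqrt_le_sqrt (by push_cast; linarith)
      have h6 := mul_le_mul_of_nonneg_left h3 (show 0 ≤ (√((n + 1 : ℕ) : ℝ) - √(n : ℝ)) / 2 by linarith)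
      have h7 := mul_le_mul_of_nonneg_left h4 (show 0 ≤ G ^ 2 / 2 by positivity)
      rw [sum_range_succ]
      linarith
  have h1 := key T hT le_rfl
  have : 0 ≤ √(T : ℝ) / 2 * ‖y T - u‖ ^ 2 := by positivity
  linarith

/-- The regret of online gradient descent with step size `1 / (lam t)` on `lam`-strongly convex
quadratic losses. -/
theorem sum_inner_ogdStrongStep_le {d : ℕ} {D Q lam : ℝ} (hD : 0 ≤ D) (hlam : 0 < lam) {T : ℕ}
    {y h x : ℕ → Vec d} {u : Vec d} (hu : ‖u‖ ≤ D)
    (hq : ∀ t < T, ‖h t + lam • (y t - x t)‖ ≤ Q)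
    (hstep : ∀ t < T, y (t + 1) = ogdStrongStep D lam (t + 1) (h t) (x t) (y t)) :
    ∑ t ∈ range T, (inner ℝ (h t + lam • (y t - x t)) (y t - u) - lam / 2 * ‖y t - u‖ ^ 2) ≤
      Q ^ 2 / (2 * lam) * (1 + Real.log T) := by
  set q : ℕ → Vec d := fun t => h t + lam • (y t - x t) with hqdef
  have key : ∀ n ≤ T, ∑ t ∈ range n, (inner ℝ (q t) (y t - u) - lam / 2 * ‖y t - u‖ ^ 2) +
      lam * n / 2 * ‖y n - u‖ ^ 2 ≤ Q ^ 2 / (2 * lam) * ∑ t ∈ range n, 1 / ((t + 1 : ℕ) : ℝ) := by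
    intro n
    induction n with
    | zero => simp
    | succ n ih =>
      intro hn
      have h1 := norm_projBall_sub_smul_sub_sq_le hD (1 / (lam * ((n + 1 : ℕ) : ℝ))) (q n) (y n) hu
      rw [show projBall D (y n - (1 / (lam * ((n + 1 : ℕ) : ℝ))) • q n) = y (n + 1) from
        (hstep n hn).symm] at h1
      have hs : (0 : ℝ) < ((n + 1 : ℕ) : ℝ) := by positivity
      have hs' : ((n + 1 : ℕ) : ℝ) = n + 1 := by push_cast; ring
      set s := ((n + 1 : ℕ) : ℝ)
      have h2 : ‖q n‖ ^ 2 ≤ Q ^ 2 := pow_le_pow_left₀ (norm_nonneg _) (hq n hn) 2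
      have h3 : lam * s / 2 * ‖y (n + 1) - u‖ ^ 2 ≤ lam * s / 2 * ‖y n - u‖ ^ 2 -
          inner ℝ (q n) (y n - u) + ‖q n‖ ^ 2 * (1 / (2 * lam) * (1 / s)) := by
        refine (mul_le_mul_of_nonneg_left h1 (by positivity)).trans (le_of_eq ?_)
        field_simp
      have h4 := mul_le_mul_of_nonneg_right h2 (show 0 ≤ 1 / (2 * lam) * (1 / s) by positivity)
      have h5 := ih (by omega)
      rw [sum_range_succ, sum_range_succ, mul_add]
      rw [hs'] at h3
      rw [show lam * s / 2 = lam * (n + 1) / 2 by rw [hs']]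
      rw [hs'] at h4
      rw [show Q ^ 2 / (2 * lam) * (1 / s) = Q ^ 2 * (1 / (2 * lam) * (1 / ((n : ℝ) + 1))) by
        rw [hs']; ring]
      linear_combination h3 + h4 + h5
  have h1 := key T le_rfl
  have h2 := mul_le_mul_of_nonneg_left (sum_one_div_succ_le T)
    (show 0 ≤ Q ^ 2 / (2 * lam) by positivity)
  have : 0 ≤ lam * T / 2 * ‖y T - u‖ ^ 2 := by positivity
  linarith

/-! ### The online Newton step -/

section Matrix

variable {d : ℕ} {S : Matrix (Fin d) (Fin d) ℝ}

theorem inner_toEuclideanLin_comm (hS : S.IsHermitian) (a b : Vec d) :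
    inner ℝ a (Matrix.toEuclideanLin S b) = inner ℝ b (Matrix.toEuclideanLin S a) := by
  rw [← (Matrix.isSymmetric_toEuclideanLin_iff.2 hS) a b, real_inner_comm]

theorem matNormSq_nonneg (hS : S.PosSemidef) (z : Vec d) : 0 ≤ matNormSq S z := by
  have := hS.dotProduct_mulVec_nonneg z.ofLp
  rw [matNormSq, EuclideanSpace.inner_eq_star_dotProduct, dotProduct_comm]
  simpa [Matrix.toEuclideanLin, Matrix.toLpLin_apply] using this

theorem matNormSq_add_smul (hS : S.IsHermitian) (a b : Vec d) (c : ℝ) :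
    matNormSq S (a + c • b) = matNormSq S a + 2 * c * inner ℝ b (Matrix.toEuclideanLin S a) +
      c ^ 2 * matNormSq S b := by
  simp only [matNormSq, map_add, map_smul, inner_add_left, inner_add_right, real_inner_smul_left,
    real_inner_smul_right]
  rw [inner_toEuclideanLin_comm hS a b]
  ring

theorem matNormSq_add_vecMulVec (S : Matrix (Fin d) (Fin d) ℝ) (q z : Vec d) :
    matNormSq (S + Matrix.vecMulVec q.ofLp q.ofLp) z = matNormSq S z + inner ℝ q z ^ 2 := by
  have : Matrix.toEuclideanLin (Matrix.vecMulVec q.ofLp q.ofLp) z = inner ℝ q z • q := by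
    ext i
    simp [Matrix.toEuclideanLin, Matrix.toLpLin_apply, Matrix.vecMulVec_mulVec,
      EuclideanSpace.inner_eq_star_dotProduct, dotProduct_comm]
  rw [matNormSq, matNormSq, map_add, LinearMap.add_apply, inner_add_right, this,
    real_inner_smul_right, real_inner_comm q z]
  ring

theorem projBallMat_spec {D : ℝ} (hD : 0 ≤ D) (S : Matrix (Fin d) (Fin d) ℝ) (y : Vec d) :
    projBallMat D S y ∈ Metric.closedBall (0 : Vec d) D ∧
      ∀ z' ∈ Metric.closedBall (0 : Vec d) D,
        matNormSq S (projBallMat D S y - y) ≤ matNormSq S (z' - y) := by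
  have hcont : Continuous fun z : Vec d => matNormSq S (z - y) := by
    have h1 : Continuous (Matrix.toEuclideanLin S) := LinearMap.continuous_of_finiteDimensional _
    unfold matNormSq
    fun_prop
  obtain ⟨z, hz, hmin⟩ := (isCompact_closedBall (0 : Vec d) D).exists_isMinOn
    ⟨0, Metric.mem_closedBall_self hD⟩ hcont.continuousOn
  exact Classical.epsilon_spec (p := fun z => z ∈ Metric.closedBall (0 : Vec d) D ∧
      ∀ z' ∈ Metric.closedBall (0 : Vec d) D, matNormSq S (z - y) ≤ matNormSq S (z' - y))
    ⟨z, hz, fun z' hz' => hmin hz'⟩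

/-- Projecting onto the ball in the norm of `S` brings a point closer, in that norm, to every point
of the ball. -/
theorem matNormSq_projBallMat_sub_le {D : ℝ} (hD : 0 ≤ D) (hS : S.PosSemidef) (y : Vec d)
    {u : Vec d} (hu : ‖u‖ ≤ D) : matNormSq S (projBallMat D S y - u) ≤ matNormSq S (y - u) := by
  obtain ⟨hp, hmin⟩ := projBallMat_spec hD S y
  set p := projBallMat D S y
  have hu' : u ∈ Metric.closedBall (0 : Vec d) D := by simpa using hu
  -- first-order optimality of `p` in the direction `u - p`
  have hopt : 0 ≤ inner ℝ (u - p) (Matrix.toEuclideanLin S (p - y)) := by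
    by_contra! hneg
    have hle : ∀ c : ℝ, 0 < c → c ≤ 1 →
        0 ≤ 2 * inner ℝ (u - p) (Matrix.toEuclideanLin S (p - y)) + c * matNormSq S (u - p) := by
      intro c hc hc1
      have hmem : p + c • (u - p) ∈ Metric.closedBall (0 : Vec d) D :=
        (convex_closedBall _ _).add_smul_sub_mem hp hu' ⟨hc.le, hc1⟩
      have h1 := hmin _ hmem
      rw [add_sub_right_comm, matNormSq_add_smul hS.1] at h1
      have h2 : 0 ≤ c * (2 * inner ℝ (u - p) (Matrix.toEuclideanLin S (p - y)) +
          c * matNormSq S (u - p)) := by linarith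
      exact nonneg_of_mul_nonneg_right h2 hc
    set a := inner ℝ (u - p) (Matrix.toEuclideanLin S (p - y))
    set m := matNormSq S (u - p)
    have hm : 0 ≤ m := matNormSq_nonneg hS _
    have h1 := hle (min 1 (-a / (m + 1))) (lt_min one_pos (by apply div_pos <;> linarith))
      (min_le_left _ _)
    have h2 : min 1 (-a / (m + 1)) * m ≤ -a := by
      refine (mul_le_mul_of_nonneg_right (min_le_right _ _) hm).trans ?_
      rw [div_mul_eq_mul_div, div_le_iff₀ (by linarith)]
      nlinarith
    linarith
  have h1 : y - u = (p - u) + (-1 : ℝ) • (p - y) := by module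
  rw [h1, matNormSq_add_smul hS.1, inner_toEuclideanLin_comm hS.1]
  have h2 : inner ℝ (p - u) (Matrix.toEuclideanLin S (p - y)) =
      -inner ℝ (u - p) (Matrix.toEuclideanLin S (p - y)) := by
    rw [← inner_neg_left, neg_sub]
  have h3 := matNormSq_nonneg hS (p - y)
  rw [h2]
  linarith

theorem toEuclideanLin_toEuclideanLin_inv (hS : IsUnit S.det) (q : Vec d) :
    Matrix.toEuclideanLin S (Matrix.toEuclideanLin S⁻¹ q) = q := by
  simp [Matrix.toEuclideanLin, Matrix.toLpLin_apply, Matrix.mulVec_mulVec,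
    Matrix.mul_nonsing_inv S hS]

theorem posDef_add_vecMulVec (hS : S.PosDef) (q : Vec d) :
    (S + Matrix.vecMulVec q.ofLp q.ofLp).PosDef :=
  hS.add_posSemidef (by simpa using Matrix.posSemidef_vecMulVec_self_star q.ofLp)

/-- By the matrix determinant lemma, `det S = det S' (1 - qᵀ S'⁻¹ q)` where `S' = S + q qᵀ`;
the bound follows from `log z ≤ z - 1`. -/
theorem inner_inv_le_log_det_sub (hS : S.PosDef) (q : Vec d) :
    inner ℝ q (Matrix.toEuclideanLin (S + Matrix.vecMulVec q.ofLp q.ofLp)⁻¹ q) ≤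
      Real.log (S + Matrix.vecMulVec q.ofLp q.ofLp).det - Real.log S.det := by
  have hS' := posDef_add_vecMulVec hS q
  set S' := S + Matrix.vecMulVec q.ofLp q.ofLp with hS'def
  have hx : inner ℝ q (Matrix.toEuclideanLin S'⁻¹ q) = q.ofLp ⬝ᵥ (S'⁻¹.mulVec q.ofLp) := by
    simp [Matrix.toEuclideanLin, Matrix.toLpLin_apply, EuclideanSpace.inner_eq_star_dotProduct,
      dotProduct_comm]
  have hdet : S.det = S'.det * (1 - q.ofLp ⬝ᵥ (S'⁻¹.mulVec q.ofLp)) := by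
    have h1 : S = S' + Matrix.replicateCol Unit (-q.ofLp) * Matrix.replicateRow Unit q.ofLp := by
      rw [← Matrix.vecMulVec_eq, Matrix.neg_vecMulVec, hS'def, add_neg_cancel_right]
    conv_lhs => rw [h1]
    rw [Matrix.det_add_replicateCol_mul_replicateRow hS'.det_pos.ne'.isUnit]
    congr 1
    rw [Matrix.det_unique, Matrix.add_apply, Matrix.one_apply_eq, Matrix.mul_assoc, ← Matrix.replicateCol_mulVec,
      Matrix.replicateRow_mul_replicateCol_apply, Matrix.mulVec_neg, dotProduct_neg]
    ring
  rw [hx]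
  set x := q.ofLp ⬝ᵥ (S'⁻¹.mulVec q.ofLp)
  have hpos : 0 < 1 - x := by
    have := hS.det_pos
    rw [hdet] at this
    exact pos_of_mul_pos_right this hS'.det_pos.le
  rw [hdet, Real.log_mul hS'.det_pos.ne' hpos.ne']
  linarith [Real.log_le_sub_one_of_pos hpos]

/-- Every eigenvalue of `S` is at most `c`. -/
theorem log_det_le (hS : S.PosDef) {c : ℝ} (hc : ∀ z, matNormSq S z ≤ c * ‖z‖ ^ 2) :
    Real.log S.det ≤ d * Real.log c := by
  rw [hS.1.det_eq_prod_eigenvalues]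
  have hpos := hS.eigenvalues_pos
  have hle : ∀ i, hS.1.eigenvalues i ≤ c := by
    intro i
    have h := hc (hS.1.eigenvectorBasis i)
    rw [OrthonormalBasis.norm_eq_one, one_pow, mul_one] at h
    refine le_trans (le_of_eq ?_) h
    rw [hS.1.eigenvalues_eq, matNormSq, EuclideanSpace.inner_eq_star_dotProduct, dotProduct_comm]
    simp [Matrix.toEuclideanLin, Matrix.toLpLin_apply]
  simp only [RCLike.ofReal_real_eq_id, id_eq]
  rw [Real.log_prod fun i _ => (hpos i).ne']
  refine (sum_le_sum fun i _ => Real.log_le_log (hpos i) (hle i)).trans (le_of_eq ?_)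
  simp

end Matrix

/-- One round of the online Newton step, with potential `β / 2 (y - u)ᵀ S (y - u)`. -/
theorem inner_sub_sq_le_onsStep {d : ℕ} {D β : ℝ} (hD : 0 ≤ D) (hβ : 0 < β) (h a y : Vec d)
    {S : Matrix (Fin d) (Fin d) ℝ} (hS : S.PosDef) {u : Vec d} (hu : ‖u‖ ≤ D) :
    inner ℝ (expLossGrad β h a y) (y - u) - β / 2 * inner ℝ (expLossGrad β h a y) (y - u) ^ 2 ≤
      1 / (2 * β) * (Real.log (onsMatStep β h a y S).det - Real.log S.det) +
        (β / 2 * matNormSq S (y - u) -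
          β / 2 * matNormSq (onsMatStep β h a y S) (onsStep D β h a y S - u)) := by
  set q := expLossGrad β h a y
  set S' := onsMatStep β h a y S
  have hS' : S'.PosDef := posDef_add_vecMulVec hS q
  set n := Matrix.toEuclideanLin S'⁻¹ q with hn
  have hSn : Matrix.toEuclideanLin S' n = q :=
    toEuclideanLin_toEuclideanLin_inv hS'.det_pos.ne'.isUnit q
  have h1 : matNormSq S' (onsStep D β h a y S - u) ≤ matNormSq S' (y - (1 / β) • n - u) :=
    matNormSq_projBallMat_sub_le hD hS'.posSemidef _ hu
  rw [show y - (1 / β) • n - u = (y - u) + (-(1 / β)) • n by module,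
    matNormSq_add_smul hS'.1, inner_toEuclideanLin_comm hS'.1, hSn,
    show matNormSq S' n = inner ℝ q n by rw [matNormSq, hSn, real_inner_comm],
    show matNormSq S' (y - u) = matNormSq S (y - u) + inner ℝ q (y - u) ^ 2 from
      matNormSq_add_vecMulVec S q (y - u), real_inner_comm q (y - u)] at h1
  have h2 : inner ℝ q n ≤ Real.log S'.det - Real.log S.det := inner_inv_le_log_det_sub hS q
  have h3 := mul_le_mul_of_nonneg_left h1 (show 0 ≤ β / 2 by positivity)
  have h4 := mul_le_mul_of_nonneg_left h2 (show 0 ≤ 1 / (2 * β) by positivity)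
  have h5 : β / 2 * (matNormSq S (y - u) + inner ℝ q (y - u) ^ 2 +
      2 * -(1 / β) * inner ℝ q (y - u) + (-(1 / β)) ^ 2 * inner ℝ q n) =
      β / 2 * matNormSq S (y - u) + β / 2 * inner ℝ q (y - u) ^ 2 - inner ℝ q (y - u) +
        1 / (2 * β) * inner ℝ q n := by
    field_simp
    ring
  rw [h5] at h3
  linarith

theorem posDef_smul_one {d : ℕ} {c : ℝ} (hc : 0 < c) :
    (c • (1 : Matrix (Fin d) (Fin d) ℝ)).PosDef := Matrix.PosDef.one.smul hc

theorem matNormSq_smul_one {d : ℕ} (c : ℝ) (z : Vec d) :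
    matNormSq (c • (1 : Matrix (Fin d) (Fin d) ℝ)) z = c * ‖z‖ ^ 2 := by
  simp [matNormSq, Matrix.toEuclideanLin, inner_smul_right]

/-- The regret of the online Newton step. The bound on `β D ‖q‖` makes every rank-one update at most
as large as the initial matrix, so that all eigenvalues grow at most by the factor `1 + T`. -/
theorem sum_inner_onsStep_le {d : ℕ} {D β : ℝ} (hD : 0 < D) (hβ : 0 < β) {T : ℕ}
    {y h a : ℕ → Vec d} {S : ℕ → Matrix (Fin d) (Fin d) ℝ} {u : Vec d} (hu : ‖u‖ ≤ D)
    (hy0 : ‖y 0‖ ≤ D) (hS0 : S 0 = (1 / (β ^ 2 * D ^ 2)) • 1)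
    (hq : ∀ t < T, β * D * ‖expLossGrad β (h t) (a t) (y t)‖ ≤ 1)
    (hS : ∀ t < T, S (t + 1) = onsMatStep β (h t) (a t) (y t) (S t))
    (hstep : ∀ t < T, y (t + 1) = onsStep D β (h t) (a t) (y t) (S t)) :
    ∑ t ∈ range T, (inner ℝ (expLossGrad β (h t) (a t) (y t)) (y t - u) -
      β / 2 * inner ℝ (expLossGrad β (h t) (a t) (y t)) (y t - u) ^ 2) ≤
      1 / (2 * β) * (d * Real.log (1 + T)) + 2 / β := by
  set c := 1 / (β ^ 2 * D ^ 2) with hc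
  have hc0 : 0 < c := by positivity
  have hpd : ∀ t ≤ T, (S t).PosDef := by
    intro t
    induction t with
    | zero => intro _; rw [hS0]; exact posDef_smul_one hc0
    | succ t ih => intro ht; rw [hS t ht]; exact posDef_add_vecMulVec (ih (by omega)) _
  have hbound : ∀ t ≤ T, ∀ z, matNormSq (S t) z ≤ c * (1 + t) * ‖z‖ ^ 2 := by
    intro t
    induction t with
    | zero => intro _ z; rw [hS0, matNormSq_smul_one]; simp
    | succ t ih =>
      intro ht z
      rw [hS t ht, onsMatStep, matNormSq_add_vecMulVec]
      have h1 := ih (by omega) z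
      have h2 : inner ℝ (expLossGrad β (h t) (a t) (y t)) z ^ 2 ≤ c * ‖z‖ ^ 2 := by
        have h3 := abs_real_inner_le_norm (expLossGrad β (h t) (a t) (y t)) z
        have h4 : ‖expLossGrad β (h t) (a t) (y t)‖ ^ 2 ≤ c := by
          rw [hc, le_div_iff₀ (by positivity)]
          have := pow_le_one₀ (n := 2) (by positivity) (hq t ht)
          linarith
        rw [← sq_abs]
        calc _ ≤ (‖expLossGrad β (h t) (a t) (y t)‖ * ‖z‖) ^ 2 :=
              pow_le_pow_left₀ (abs_nonneg _) h3 2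
          _ ≤ _ := by rw [mul_pow]; exact mul_le_mul_of_nonneg_right h4 (sq_nonneg _)
      push_cast
      linarith
  have hsum : ∀ n ≤ T, ∑ t ∈ range n, (inner ℝ (expLossGrad β (h t) (a t) (y t)) (y t - u) -
      β / 2 * inner ℝ (expLossGrad β (h t) (a t) (y t)) (y t - u) ^ 2) ≤
      1 / (2 * β) * (Real.log (S n).det - Real.log (S 0).det) +
        (β / 2 * matNormSq (S 0) (y 0 - u) - β / 2 * matNormSq (S n) (y n - u)) := by
    intro n
    induction n with
    | zero => simp
    | succ n ih =>
      intro hn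
      have h1 := inner_sub_sq_le_onsStep hD.le hβ (h n) (a n) (y n) (hpd n (by omega)) hu
      rw [← hS n hn, ← hstep n hn] at h1
      rw [sum_range_succ]
      linarith [ih (by omega)]
  refine (hsum T le_rfl).trans (add_le_add ?_ ?_)
  · refine mul_le_mul_of_nonneg_left ?_ (by positivity)
    have h1 := log_det_le (hpd T le_rfl) (hbound T le_rfl)
    rw [Real.log_mul hc0.ne' (by positivity)] at h1
    have h2 : Real.log (S 0).det = d * Real.log c := by
      rw [hS0, Matrix.det_smul, Matrix.det_one, mul_one, Fintype.card_fin, Real.log_pow]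
    rw [h2]
    linarith
  · have h1 := matNormSq_nonneg (hpd T le_rfl).posSemidef (y T - u)
    have h2 := norm_sub_sq_le_four_mul_sq hy0 hu
    have h3 : β / 2 * matNormSq (S 0) (y 0 - u) ≤ 2 / β := by
      rw [hS0, matNormSq_smul_one]
      refine (mul_le_mul_of_nonneg_left (mul_le_mul_of_nonneg_left h2 hc0.le)
        (by positivity)).trans (le_of_eq ?_)
      rw [hc]
      field_simp
      ring
    have h4 : 0 ≤ β / 2 * matNormSq (S T) (y T - u) := by positivity
    linarith

/-! ### The surrogate losses -/

theorem IsProjectionOnto.inner_sub_sub_le_zero {d : ℕ} {X : Set (Vec d)} {P : Vec d → Vec d}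
    (hP : IsProjectionOnto X P) (hX : Convex ℝ X) (y : Vec d) {u : Vec d} (hu : u ∈ X) :
    inner ℝ (y - P y) (u - P y) ≤ 0 := by
  refine (norm_eq_iInf_iff_real_inner_le_zero hX (hP y).1).1 (le_antisymm ?_ ?_) u hu
  · have : Nonempty X := ⟨⟨u, hu⟩⟩
    exact le_ciInf fun w => (hP y).2 w w.2
  · exact ciInf_le ⟨0, by rintro _ ⟨w, rfl⟩; exact norm_nonneg _⟩ (⟨P y, (hP y).1⟩ : X)

theorem norm_smul_inv_norm_le_one {d : ℕ} (w : Vec d) : ‖‖w‖⁻¹ • w‖ ≤ 1 := by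
  rw [norm_smul, norm_inv, norm_norm]
  exact inv_mul_le_one

theorem norm_surrogateGrad_le {d : ℕ} (g x y : Vec d) : ‖surrogateGrad g x y‖ ≤ ‖g‖ := by
  simp only [surrogateGrad]
  split_ifs with h
  · have hv := norm_smul_inv_norm_le_one (y - x)
    set v := ‖y - x‖⁻¹ • (y - x)
    refine abs_le_of_sq_le_sq' ?_ (norm_nonneg _) |>.2
    rw [norm_sub_sq_real, real_inner_smul_right, norm_smul, mul_pow, Real.norm_eq_abs, sq_abs]
    have h1 : ‖v‖ ^ 2 ≤ 1 := pow_le_one₀ (norm_nonneg _) hv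
    nlinarith [mul_le_mul_of_nonneg_left h1 (sq_nonneg (inner ℝ g v)), sq_nonneg (inner ℝ g v)]
  · exact le_rfl

theorem inner_surrogateGrad_sub_nonneg {d : ℕ} (g x y : Vec d) :
    0 ≤ inner ℝ (surrogateGrad g x y) (y - x) := by
  rcases eq_or_ne (y - x) 0 with h0 | h0
  · rw [h0, inner_zero_right]
  have hn : 0 < ‖y - x‖ := norm_pos_iff.2 h0
  have hw : y - x = ‖y - x‖ • (‖y - x‖⁻¹ • (y - x)) := by
    rw [smul_smul, mul_inv_cancel₀ hn.ne', one_smul]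
  have hv : ‖‖y - x‖⁻¹ • (y - x)‖ = 1 := by
    rw [norm_smul, norm_inv, norm_norm, inv_mul_cancel₀ hn.ne']
  simp only [surrogateGrad]
  set v := ‖y - x‖⁻¹ • (y - x)
  rw [hw, real_inner_smul_right]
  refine mul_nonneg hn.le ?_
  split_ifs with h
  · rw [inner_sub_left, real_inner_smul_left, real_inner_self_eq_norm_sq, hv]
    simp
  · exact not_lt.1 h

/-- The hypothesis holds if `x` is the projection of `y` onto a convex set that contains `u`. -/
theorem inner_le_inner_surrogateGrad {d : ℕ} (g : Vec d) {x y u : Vec d}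
    (hproj : inner ℝ (y - x) (u - x) ≤ 0) :
    inner ℝ g (x - u) ≤ inner ℝ (surrogateGrad g x y) (x - u) := by
  simp only [surrogateGrad]
  split_ifs with h
  · have h1 : 0 ≤ inner ℝ (‖y - x‖⁻¹ • (y - x)) (x - u) := by
      rw [real_inner_smul_left, ← neg_sub u x, inner_neg_right]
      exact mul_nonneg (by positivity) (by linarith)
    rw [inner_sub_left, real_inner_smul_left]
    nlinarith
  · exact le_rfl

/-! ### Curvature of the losses -/

/-- The gradient inequality for a convex function, with the derivative within a set that may have
empty interior. -/
theorem ConvexOn.add_fderivWithin_le {d : ℕ} {X : Set (Vec d)} {f : Vec d → ℝ}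
    (hf : ConvexOn ℝ X f) {x u : Vec d} (hx : x ∈ X) (hu : u ∈ X) {f' : Vec d →L[ℝ] ℝ}
    (hf' : HasFDerivWithinAt f f' X x) : f x + f' (u - x) ≤ f u := by
  have hmem : Set.MapsTo (fun s : ℝ => x + s • (u - x)) (Set.Icc 0 1) X := fun s hs =>
    hf.1.add_smul_sub_mem hx hu hs
  have hline : HasDerivWithinAt (fun s : ℝ => x + s • (u - x)) (u - x) (Set.Icc 0 1) 0 := by
    simpa using (((hasDerivWithinAt_id (0 : ℝ) (Set.Icc 0 1)).smul_const (u - x)).const_add x)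
  have hcomp : HasDerivWithinAt (fun s : ℝ => f (x + s • (u - x))) (f' (u - x))
      (Set.Icc 0 1) 0 := by
    have hf'' : HasFDerivWithinAt f f' X (x + (0 : ℝ) • (u - x)) := by simpa using hf'
    exact hf''.comp_hasDerivWithinAt 0 hline hmem
  rw [hasDerivWithinAt_iff_tendsto_slope, Set.Icc_sdiff_left] at hcomp
  have hne : (nhdsWithin (0 : ℝ) (Set.Ioc 0 1)).NeBot := by
    rw [nhdsWithin_Ioc_eq_nhdsGT (by norm_num : (0 : ℝ) < 1)]
    infer_instance
  suffices f' (u - x) ≤ f u - f x by linarith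
  refine le_of_tendsto hcomp ?_
  filter_upwards [self_mem_nhdsWithin] with s hs
  have h1 := hf.2 hx hu (show 0 ≤ 1 - s by linarith [hs.2]) hs.1.le (by ring)
  rw [slope_def_field, sub_zero, div_le_iff₀ hs.1, zero_smul, add_zero,
    show x + s • (u - x) = (1 - s) • x + s • u by module]
  simp only [smul_eq_mul] at h1
  linarith

theorem ConvexOn.sub_le_inner {d : ℕ} {X : Set (Vec d)} {f : Vec d → ℝ}
    (hf : ConvexOn ℝ X f) {x u g : Vec d} (hx : x ∈ X) (hu : u ∈ X)
    (hg : HasGradientWithinAt f g X x) : f x - f u ≤ inner ℝ g (x - u) := by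
  have := hf.add_fderivWithin_le hx hu hg.hasFDerivWithinAt
  rw [InnerProductSpace.toDual_apply_apply, ← neg_sub x u, inner_neg_right] at this
  linarith

/-- The curvature of an `α`-exp-concave loss, in logarithmic form; it holds with every smaller
parameter `γ` by Bernoulli's inequality. -/
theorem IsExpConcaveOn.mul_sub_le_log {d : ℕ} {X : Set (Vec d)} {f : Vec d → ℝ} {α γ : ℝ}
    (hf : IsExpConcaveOn X α f) (hγ : 0 < γ) (hγα : γ ≤ α) {x u g : Vec d} (hx : x ∈ X)
    (hu : u ∈ X) (hg : HasGradientWithinAt f g X x) :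
    0 < 1 + γ * inner ℝ g (x - u) ∧ γ * (f x - f u) ≤ Real.log (1 + γ * inner ℝ g (x - u)) := by
  have hα : 0 < α := hγ.trans_le hγα
  set s := inner ℝ g (x - u) with hs
  have h1 : Real.exp (α * (f x - f u)) ≤ 1 + α * s := by
    have hfd : HasFDerivWithinAt (fun z => -Real.exp (-α * f z))
        (-(Real.exp (-α * f x) • (-α) • (InnerProductSpace.toDual ℝ (Vec d) g))) X x :=
      ((hg.hasFDerivWithinAt.const_mul (-α)).exp).neg
    have h2 := hf.neg.add_fderivWithin_le hx hu hfd
    simp only [Pi.neg_apply, neg_apply, smul_apply,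
      InnerProductSpace.toDual_apply_apply, smul_eq_mul] at h2
    rw [← neg_sub x u, inner_neg_right, ← hs] at h2
    have h3 : Real.exp (-α * f u) = Real.exp (-α * f x) * Real.exp (α * (f x - f u)) := by
      rw [← Real.exp_add]; congr 1; ring
    rw [h3] at h2
    have h4 : Real.exp (-α * f x) * Real.exp (α * (f x - f u)) ≤
        Real.exp (-α * f x) * (1 + α * s) := by linarith
    exact le_of_mul_le_mul_left h4 (Real.exp_pos _)
  have hpos : 0 < 1 + α * s := (Real.exp_pos _).trans_le h1
  have h5 : Real.exp (γ * (f x - f u)) ≤ 1 + γ * s := by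
    calc Real.exp (γ * (f x - f u)) = Real.exp (α * (f x - f u)) ^ (γ / α) := by
          rw [← Real.exp_mul]; congr 1; field_simp
      _ ≤ (1 + α * s) ^ (γ / α) :=
          Real.rpow_le_rpow (Real.exp_pos _).le h1 (by positivity)
      _ ≤ 1 + γ / α * (α * s) :=
          rpow_one_add_le_one_add_mul_self (by linarith) (by positivity) ((div_le_one hα).2 hγα)
      _ = 1 + γ * s := by field_simp
  have hpos' : 0 < 1 + γ * s := (Real.exp_pos _).trans_le h5
  exact ⟨hpos', (Real.le_log_iff_exp_le hpos').2 h5⟩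

/-- One round with an exp-concave loss: the first two terms on the right are the regret of the
meta-algorithm minus a fraction of its variance, the last two are what the online Newton step
controls. -/
theorem IsExpConcaveOn.sub_le_inner_add_expLoss {d : ℕ} {X : Set (Vec d)} {f : Vec d → ℝ}
    {α β G D : ℝ} (hf : IsExpConcaveOn X α f) (hβ : 0 < β) (hβα : 2 * β ≤ α)
    (hβGD : β * (2 * G * D) ≤ 1 / 4)
    {x u g h a y : Vec d} (hx : x ∈ X) (hu : u ∈ X) (hg : HasGradientWithinAt f g X x)
    (hgh : inner ℝ g (x - u) ≤ inner ℝ h (a - u)) (hh : ‖h‖ ≤ G) (ha : ‖a‖ ≤ D) (hy : ‖y‖ ≤ D)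
    (huD : ‖u‖ ≤ D) :
    f x - f u ≤ inner ℝ h (a - y) - β / 16 * inner ℝ h (a - y) ^ 2 +
      (inner ℝ (expLossGrad β h a y) (y - u) -
        β / 2 * inner ℝ (expLossGrad β h a y) (y - u) ^ 2) := by
  have habs : ∀ p q : Vec d, ‖p‖ ≤ D → ‖q‖ ≤ D → |β * inner ℝ h (p - q)| ≤ 1 / 4 := by
    intro p q hp hq
    rw [abs_mul, abs_of_pos hβ]
    refine le_trans (mul_le_mul_of_nonneg_left ?_ hβ.le) hβGD
    refine (abs_real_inner_le_norm _ _).trans ?_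
    have h1 : ‖p - q‖ ≤ 2 * D := (norm_sub_le p q).trans (by linarith)
    calc ‖h‖ * ‖p - q‖ ≤ G * (2 * D) :=
          mul_le_mul hh h1 (norm_nonneg _) ((norm_nonneg _).trans hh)
      _ = 2 * G * D := by ring
  obtain ⟨hpos, hlog⟩ := hf.mul_sub_le_log (γ := 2 * β) (by linarith) hβα hx hu hg
  have hsub : β * inner ℝ h (a - u) = β * inner ℝ h (y - u) - β * inner ℝ h (y - a) := by
    rw [← mul_sub, ← inner_sub_right]; congr 2; abel
  have hkey := half_log_le_of_abs_le (b := β * inner ℝ h (y - a)) (e := β * inner ℝ h (y - u))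
    (habs y u hy huD) (hsub ▸ habs a u ha huD)
  have hmono : Real.log (1 + 2 * β * inner ℝ g (x - u)) ≤
      Real.log (1 + 2 * (β * inner ℝ h (y - u) - β * inner ℝ h (y - a))) := by
    refine Real.log_le_log hpos ?_
    rw [← hsub]
    nlinarith
  have hq : inner ℝ (expLossGrad β h a y) (y - u) =
      (1 + β * inner ℝ h (y - a)) * inner ℝ h (y - u) := by
    rw [expLossGrad, inner_add_left, real_inner_smul_left]; ring
  have hz : inner ℝ h (a - y) = -inner ℝ h (y - a) := by rw [← inner_neg_right, neg_sub]
  rw [hq, hz]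
  refine le_of_mul_le_mul_left ?_ hβ
  linear_combination 1 / 2 * hlog + hkey + 1 / 2 * hmono

/-- One round with a strongly convex loss. The meta-algorithm is charged a multiple of
`⟨h, a - y⟩ ^ 2`, where `a - y = (a - x) + (x - y)`; the surrogate loss pays for the first part,
which leaves the domain, and strong convexity for the second one. -/
theorem sub_le_of_strongConvex {d : ℕ} {G D lam c F : ℝ} (hc : 0 ≤ c)
    (hclam : 2 * c * G ^ 2 ≤ lam) (hcGD : 2 * c * (G * D) ≤ 1)
    {x u g h a y : Vec d} (hF : F ≤ inner ℝ g (x - u) - lam / 2 * ‖u - x‖ ^ 2)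
    (hgh : inner ℝ g (x - u) ≤ inner ℝ h (x - u)) (hp : 0 ≤ inner ℝ h (a - x)) (hh : ‖h‖ ≤ G)
    (hax : ‖a - x‖ ≤ 2 * D) :
    F ≤ inner ℝ h (a - y) - c / 2 * inner ℝ h (a - y) ^ 2 +
      (inner ℝ (h + lam • (y - x)) (y - u) - lam / 2 * ‖y - u‖ ^ 2) := by
  set p := inner ℝ h (a - x) with hpdef
  set r := inner ℝ h (x - y) with hr
  have hsum : inner ℝ h (a - y) = p + r := by
    rw [hpdef, hr, ← inner_add_right]; congr 1; abel
  have hG : 0 ≤ G := (norm_nonneg _).trans hh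
  have hp2 : p ≤ 2 * (G * D) := by
    refine (real_inner_le_norm _ _).trans ?_
    calc ‖h‖ * ‖a - x‖ ≤ G * (2 * D) := mul_le_mul hh hax (norm_nonneg _) hG
      _ = _ := by ring
  have hr2 : r ^ 2 ≤ G ^ 2 * ‖y - x‖ ^ 2 := by
    rw [← sq_abs, ← mul_pow, norm_sub_rev]
    exact pow_le_pow_left₀ (abs_nonneg _)
      ((abs_real_inner_le_norm _ _).trans (mul_le_mul_of_nonneg_right hh (norm_nonneg _))) 2
  have h1 : c / 2 * (p + r) ^ 2 ≤ p + lam / 2 * ‖y - x‖ ^ 2 := by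
    have h2 : c / 2 * (p + r) ^ 2 ≤ c * p ^ 2 + c * r ^ 2 := by
      nlinarith [mul_nonneg hc (sq_nonneg (p - r))]
    have h3 : c * p ^ 2 ≤ p := by
      have : c * p ≤ 1 := (mul_le_mul_of_nonneg_left hp2 hc).trans (by linarith)
      nlinarith
    have h4 : c * r ^ 2 ≤ lam / 2 * ‖y - x‖ ^ 2 := by
      have h5 := mul_le_mul_of_nonneg_left hr2 hc
      have h6 := mul_le_mul_of_nonneg_right hclam (sq_nonneg ‖y - x‖)
      linarith
    linarith
  have h7 : inner ℝ h (x - u) = inner ℝ h (y - u) + r := by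
    rw [hr, ← inner_add_right]; congr 1; abel
  have h8 : ‖u - x‖ ^ 2 = ‖y - x‖ ^ 2 - 2 * inner ℝ (y - x) (y - u) + ‖y - u‖ ^ 2 := by
    rw [← norm_sub_sq_real]; congr 2; abel
  rw [hsum, inner_add_left, real_inner_smul_left]
  rw [h8] at hF
  linarith

/-! ### The run of the universal algorithm -/

/-- The properties of a run of the universal algorithm for `T` rounds on which its regret depends:
`x t`, `a t` and `h t` are the decision, the aggregated decision and the gradient of the surrogate
loss in round `t`, and `y t` and `S t` are the decisions and the matrices of the experts. -/
structure IsUniversalRun {d : ℕ} (G D : ℝ) (T : ℕ) (x a h : ℕ → Vec d) (y : ℕ → Expert T → Vec d)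
    (S : ℕ → Grid T → Matrix (Fin d) (Fin d) ℝ) : Prop where
  norm_expert_le : ∀ t ≤ T, ∀ i, ‖y t i‖ ≤ D
  norm_agg_le : ∀ t < T, ‖a t‖ ≤ D
  norm_grad_le : ∀ t < T, ‖h t‖ ≤ G
  convex_step : ∀ t < T, y (t + 1) (Sum.inl ()) =
    ogdConvexStep D (t + 1) (h t) (y t (Sum.inl ()))
  exp_step : ∀ t < T, ∀ k, y (t + 1) (Sum.inr (Sum.inl k)) =
    onsStep D (expBeta G D (modulus T k)) (h t) (a t) (y t (Sum.inr (Sum.inl k))) (S t k)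
  mat_zero : ∀ k, S 0 k = (1 / (expBeta G D (modulus T k) ^ 2 * D ^ 2)) • 1
  mat_step : ∀ t < T, ∀ k, S (t + 1) k =
    onsMatStep (expBeta G D (modulus T k)) (h t) (a t) (y t (Sum.inr (Sum.inl k))) (S t k)
  strong_step : ∀ t < T, ∀ k, y (t + 1) (Sum.inr (Sum.inr k)) =
    ogdStrongStep D (modulus T k) (t + 1) (h t) (x t) (y t (Sum.inr (Sum.inr k)))
  meta_regret : ∀ i, ∑ t ∈ range T, inner ℝ (h t) (a t - y t i) ≤ 4 * G * D * (metaGamma T *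
    (2 + √(1 + (∑ t ∈ range T, inner ℝ (h t) (a t - y t i) ^ 2) / (4 * G * D) ^ 2) /
      √(Real.log (numExperts T))))

namespace UniState

variable {d T : ℕ}

/-- The invariant of the states of the universal algorithm: the weights make `prob` a probability
distribution, and the experts stay in the ball. -/
structure Valid (D : ℝ) (s : UniState d T) : Prop where
  sq_nonneg : ∀ i, 0 ≤ s.sq i
  weight_pos : ∀ i, 0 < s.weight i
  norm_expert_le : ∀ i, ‖s.expert i‖ ≤ D

variable {D G : ℝ} {s : UniState d T}

theorem Valid.rate_mul_weight_pos (hs : s.Valid D) (hT : 2 ≤ T) (i : Expert T) :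
    0 < metaRate T (s.sq i) * s.weight i :=
  mul_pos (metaRate_pos hT (hs.sq_nonneg i)) (hs.weight_pos i)

theorem Valid.sum_rate_mul_weight_pos (hs : s.Valid D) (hT : 2 ≤ T) :
    0 < ∑ j, metaRate T (s.sq j) * s.weight j :=
  sum_pos (fun i _ => hs.rate_mul_weight_pos hT i) univ_nonempty

theorem Valid.sum_prob (hs : s.Valid D) (hT : 2 ≤ T) : ∑ i, s.prob i = 1 := by
  simp only [prob]
  rw [← sum_div, div_self (hs.sum_rate_mul_weight_pos hT).ne']

theorem Valid.norm_aggregate_le (hs : s.Valid D) (hT : 2 ≤ T) : ‖s.aggregate‖ ≤ D := by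
  have h0 : ∀ i, 0 ≤ s.prob i := fun i =>
    div_nonneg (hs.rate_mul_weight_pos hT i).le (hs.sum_rate_mul_weight_pos hT).le
  calc ‖s.aggregate‖ ≤ ∑ i, ‖s.prob i • s.expert i‖ := norm_sum_le _ _
    _ ≤ ∑ i, s.prob i * D := sum_le_sum fun i _ => by
        rw [norm_smul, Real.norm_of_nonneg (h0 i)]
        exact mul_le_mul_of_nonneg_left (hs.norm_expert_le i) (h0 i)
    _ = D := by rw [← sum_mul, hs.sum_prob hT, one_mul]

theorem Valid.sum_prob_mul_inner (hs : s.Valid D) (hT : 2 ≤ T) (h : Vec d) :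
    ∑ i, s.prob i * inner ℝ h (s.aggregate - s.expert i) = 0 := by
  simp only [inner_sub_right, mul_sub, sum_sub_distrib]
  rw [← sum_mul, hs.sum_prob hT, one_mul]
  conv_lhs => enter [1]; rw [aggregate, inner_sum]
  simp only [real_inner_smul_right, sub_self]

theorem Valid.excess_eq (hs : s.Valid D) (hT : 2 ≤ T) (h x : Vec d) (i : Expert T) :
    UniState.excess G D { s with agg := s.aggregate, played := x } h i =
      inner ℝ h (s.aggregate - s.expert i) / (4 * G * D) := by
  have h1 : ∀ j, s.prob j * (inner ℝ h (s.expert j - s.aggregate) / (4 * G * D) + 1 / 2) =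
      -(s.prob j * inner ℝ h (s.aggregate - s.expert j)) / (4 * G * D) + s.prob j * (1 / 2) := by
    intro j
    rw [← neg_sub s.aggregate, inner_neg_right]
    ring
  change (∑ j, s.prob j * (inner ℝ h (s.expert j - s.aggregate) / (4 * G * D) + 1 / 2)) -
    (inner ℝ h (s.expert i - s.aggregate) / (4 * G * D) + 1 / 2) = _
  rw [sum_congr rfl fun j _ => h1 j, sum_add_distrib, ← sum_div, sum_neg_distrib, ← sum_mul,
    hs.sum_prob hT, hs.sum_prob_mul_inner hT, ← neg_sub s.aggregate, inner_neg_right]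
  ring

theorem Valid.abs_excess_le (hs : s.Valid D) (hT : 2 ≤ T) (hG : 0 < G) (hD : 0 < D)
    {h : Vec d} (hh : ‖h‖ ≤ G) (x : Vec d) (i : Expert T) :
    |UniState.excess G D { s with agg := s.aggregate, played := x } h i| ≤ 1 / 2 := by
  rw [hs.excess_eq hT, abs_div, abs_of_pos (show 0 < 4 * G * D by positivity),
    div_le_iff₀ (by positivity)]
  have h1 : ‖s.aggregate - s.expert i‖ ≤ 2 * D :=
    (norm_sub_le _ _).trans (by linarith [hs.norm_aggregate_le hT, hs.norm_expert_le i])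
  calc _ ≤ ‖h‖ * ‖s.aggregate - s.expert i‖ := abs_real_inner_le_norm _ _
    _ ≤ G * (2 * D) := mul_le_mul hh h1 (norm_nonneg _) hG.le
    _ = _ := by ring

theorem norm_onsStep_le (hD : 0 ≤ D) (β : ℝ) (h a y : Vec d) (S : Matrix (Fin d) (Fin d) ℝ) :
    ‖onsStep D β h a y S‖ ≤ D := by
  rw [onsStep, ← mem_closedBall_zero_iff]
  exact (projBallMat_spec hD (onsMatStep β h a y S) _).1

theorem Valid.next (hs : s.Valid D) (hT : 2 ≤ T) (hG : 0 < G) (hD : 0 < D)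
    {h : Vec d} (hh : ‖h‖ ≤ G) (x : Vec d) :
    (UniState.next G D { s with agg := s.aggregate, played := x } h).Valid D where
  sq_nonneg i := add_nonneg (hs.sq_nonneg i) (_root_.sq_nonneg _)
  weight_pos i := by
    have h1 := abs_le.1 (hs.abs_excess_le hT hG hD hh x i)
    have h2 := metaRate_pos hT (hs.sq_nonneg i)
    have h3 := metaRate_le_half T (s.sq i)
    refine Real.rpow_pos_of_pos (mul_pos (hs.weight_pos i) ?_) _
    change 0 < 1 + metaRate T (s.sq i) * _
    nlinarith
  norm_expert_le i := by
    rcases i with _ | k | k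
    · exact norm_projBall_le hD.le _
    · exact norm_onsStep_le hD.le _ _ _ _ _
    · exact norm_projBall_le hD.le _

end UniState

section Run

variable {d T : ℕ} (G D : ℝ) (y₁ : Expert T → Vec d) (P : Vec d → Vec d) (df : ℕ → Vec d → Vec d)

/-- The gradient, at the aggregated decision, of the surrogate loss in round `t`. -/
noncomputable def runGrad (t : ℕ) : Vec d :=
  surrogateGrad (df t ((universalAlgorithm G D T y₁).decision P df t))
    ((universalAlgorithm G D T y₁).decision P df t)
    ((universalAlgorithm G D T y₁).stateAt P df t : UniState d T).aggregate

theorem stateAt_succ (t : ℕ) : (universalAlgorithm G D T y₁).stateAt P df (t + 1) =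
    UniState.next G D { (universalAlgorithm G D T y₁).stateAt P df t with
      agg := ((universalAlgorithm G D T y₁).stateAt P df t : UniState d T).aggregate
      played := (universalAlgorithm G D T y₁).decision P df t } (runGrad G D y₁ P df t) := rfl

theorem projections_eq_one (t : ℕ) : (universalAlgorithm G D T y₁).projections P df t = 1 := rfl

theorem stateAt_round (t : ℕ) :
    ((universalAlgorithm G D T y₁).stateAt P df t : UniState d T).round = t + 1 := by
  induction t with
  | zero => rfl
  | succ t ih =>
    rw [stateAt_succ]
    change UniState.round _ + 1 = _
    rw [ih]

variable {G D y₁ P df}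

theorem isUniversalRun (hG : 0 < G) (hD : 0 < D) (hT : 2 ≤ T) (hy₁ : ∀ i, ‖y₁ i‖ ≤ D)
    (hdf : ∀ t < T, ‖df t ((universalAlgorithm G D T y₁).decision P df t)‖ ≤ G) :
    IsUniversalRun G D T ((universalAlgorithm G D T y₁).decision P df)
      (fun t => ((universalAlgorithm G D T y₁).stateAt P df t : UniState d T).aggregate)
      (runGrad G D y₁ P df)
      (fun t => ((universalAlgorithm G D T y₁).stateAt P df t : UniState d T).expert)
      (fun t => ((universalAlgorithm G D T y₁).stateAt P df t : UniState d T).mat) := by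
  set s : ℕ → UniState d T := (universalAlgorithm G D T y₁).stateAt P df with hs
  set x := (universalAlgorithm G D T y₁).decision P df
  set h := runGrad G D y₁ P df
  have hsucc : ∀ t, s (t + 1) = UniState.next G D
      { s t with agg := (s t).aggregate, played := x t } (h t) := stateAt_succ G D y₁ P df
  have hround : ∀ t, (s t).round = t + 1 := stateAt_round G D y₁ P df
  have hh : ∀ t < T, ‖h t‖ ≤ G := fun t ht => (norm_surrogateGrad_le _ _ _).trans (hdf t ht)
  have hvalid : ∀ t ≤ T, (s t).Valid D := by
    intro t
    induction t with
    | zero =>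
      intro _
      refine ⟨fun _ => le_rfl, fun _ => ?_, hy₁⟩
      have : 0 < numExperts T := by linarith [five_le_numExperts hT]
      change (0 : ℝ) < 1 / numExperts T
      positivity
    | succ t ih =>
      intro ht
      rw [hsucc]
      exact (ih (by omega)).next hT hG hD (hh t ht) _
  have hexcess : ∀ t < T, ∀ i,
      UniState.excess G D { s t with agg := (s t).aggregate, played := x t } (h t) i =
        inner ℝ (h t) ((s t).aggregate - (s t).expert i) / (4 * G * D) :=
    fun t ht i => (hvalid t ht.le).excess_eq hT _ _ i
  have hGD : 0 < 4 * G * D := by positivity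
  have hprod : IsAdaptMLProd T (fun t => (s t).weight) (fun t => (s t).sq) fun t i =>
      UniState.excess G D { s t with agg := (s t).aggregate, played := x t } (h t) i := by
    refine ⟨fun i => rfl, fun i => rfl, fun t _ i => ?_, fun t _ i => ?_, fun t ht i => ?_,
      fun t ht => ?_⟩
    · simp only [hsucc]; rfl
    · simp only [hsucc]; rfl
    · exact (hvalid t ht.le).abs_excess_le hT hG hD (hh t ht) _ i
    · have h1 := (hvalid t ht.le).sum_prob_mul_inner hT (h t)
      have h2 := (hvalid t ht.le).sum_rate_mul_weight_pos hT
      have h3 : ∀ i, metaRate T ((s t).sq i) * (s t).weight i *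
          UniState.excess G D { s t with agg := (s t).aggregate, played := x t } (h t) i =
          (∑ j, metaRate T ((s t).sq j) * (s t).weight j) / (4 * G * D) *
            ((s t).prob i * inner ℝ (h t) ((s t).aggregate - (s t).expert i)) := by
        intro i
        rw [hexcess t ht, UniState.prob]
        field_simp
      rw [sum_congr rfl fun i _ => h3 i, ← mul_sum, h1, mul_zero]
  have hsq : ∀ i, ∀ n ≤ T, (s n).sq i = (∑ t ∈ range n,
      inner ℝ (h t) ((s t).aggregate - (s t).expert i) ^ 2) / (4 * G * D) ^ 2 := by
    intro i n
    induction n with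
    | zero => intro _; rw [hprod.sq_zero i]; simp
    | succ n ih =>
      intro hn
      rw [hprod.sq_succ n hn i, ih (by omega), sum_range_succ, hexcess n hn]
      ring
  refine ⟨fun t ht i => (hvalid t ht).norm_expert_le i,
    fun t ht => (hvalid t ht.le).norm_aggregate_le hT, hh, fun t _ => ?_, fun t _ k => ?_,
    fun k => rfl, fun t _ k => ?_, fun t _ k => ?_, fun i => ?_⟩
  · simp only [hsucc]
    change ogdConvexStep D (s t).round _ _ = _
    rw [hround]
  · simp only [hsucc]; rfl
  · simp only [hsucc]; rfl
  · simp only [hsucc]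
    change ogdStrongStep D _ (s t).round _ _ _ = _
    rw [hround]
  · have h1 := hprod.sum_excess_le hT i
    rw [hsq i T le_rfl, sum_congr rfl fun t ht => hexcess t (mem_range.1 ht) i, ← sum_div,
      div_le_iff₀ hGD] at h1
    linarith

end Run

/-! ### The regret bounds -/

/-- The sum of squares in the second-order bound of the meta-algorithm, traded for a multiple of
itself by the inequality of arithmetic and geometric means. -/
theorem mul_metaGamma_mul_le {G D c Q : ℝ} (hG : 0 < G) (hD : 0 < D) (hc : 0 < c) (hQ : 0 ≤ Q)
    {T : ℕ} (hT : 2 ≤ T) :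
    4 * G * D * (metaGamma T * (2 + √(1 + Q / (4 * G * D) ^ 2) / √(Real.log (numExperts T)))) ≤
      60 * (G * D) * Real.log (numExperts T) + 25 / 2 * (Real.log (numExperts T) / c) +
        c / 2 * Q := by
  have hL := one_le_log_numExperts hT
  have hΓ := metaGamma_le hT
  set L := Real.log (numExperts T)
  set p := √L
  have hp : 1 ≤ p := Real.one_le_sqrt.2 hL
  have hp2 : p ^ 2 = L := Real.sq_sqrt (by linarith)
  have hGD : 0 < 4 * G * D := by positivity
  set q := √Q
  have hq2 : q ^ 2 = Q := Real.sq_sqrt hQ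
  have hq : 0 ≤ q := Real.sqrt_nonneg _
  have h1 : √(1 + Q / (4 * G * D) ^ 2) ≤ 1 + q / (4 * G * D) := by
    refine Real.sqrt_le_iff.2 ⟨by positivity, ?_⟩
    have h0 : 0 ≤ q / (4 * G * D) := by positivity
    rw [← hq2, ← div_pow]
    nlinarith
  have h2 : metaGamma T * (2 + √(1 + Q / (4 * G * D) ^ 2) / p) ≤
      5 * p ^ 2 * (2 + (1 + q / (4 * G * D)) / p) := by
    rw [hp2]
    refine mul_le_mul hΓ ?_ (by positivity) (by linarith)
    gcongr
  refine (mul_le_mul_of_nonneg_left h2 hGD.le).trans ?_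
  have h3 : 4 * G * D * (5 * p ^ 2 * (2 + (1 + q / (4 * G * D)) / p)) =
      4 * G * D * (10 * p ^ 2 + 5 * p) + 5 * p * q := by
    field_simp
    ring
  have h4 : 5 * p * q ≤ 25 / 2 * (L / c) + c / 2 * Q := by
    rw [← hp2, ← hq2]
    have h5 : 25 / 2 * (p ^ 2 / c) + c / 2 * q ^ 2 - 5 * p * q = (5 * p - c * q) ^ 2 / (2 * c) := by
      field_simp
      ring
    have h6 : 0 ≤ (5 * p - c * q) ^ 2 / (2 * c) := by positivity
    linarith
  have h7 : 4 * G * D * (10 * p ^ 2 + 5 * p) ≤ 60 * (G * D) * L := by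
    rw [← hp2]
    have : 5 * p ≤ 5 * p ^ 2 := by nlinarith
    nlinarith
  rw [h3]
  linarith

namespace IsUniversalRun

variable {d T : ℕ} {G D : ℝ} {x a h : ℕ → Vec d} {y : ℕ → Expert T → Vec d}
  {S : ℕ → Grid T → Matrix (Fin d) (Fin d) ℝ} {u : Vec d}

theorem sum_inner_le_of_convex (H : IsUniversalRun G D T x a h y S) (hG : 0 < G) (hD : 0 < D)
    (hT : 2 ≤ T) (hu : ‖u‖ ≤ D) :
    ∑ t ∈ range T, inner ℝ (h t) (a t - u) ≤
      4 * metaGamma T * G * D * (2 + 1 / √(Real.log (numExperts T))) +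
        (2 * metaGamma T * G * D / √(Real.log (numExperts T)) + 2 * D ^ 2 + G ^ 2) * √(T : ℝ) -
        G ^ 2 / 2 := by
  have h1 := H.meta_regret (Sum.inl ())
  have h2 := sum_inner_ogdConvexStep_le hD.le (by omega : 1 ≤ T) hu
    (fun t ht => H.norm_expert_le t ht (Sum.inl ())) H.norm_grad_le H.convex_step
  have h3 : ∑ t ∈ range T, inner ℝ (h t) (a t - u) =
      ∑ t ∈ range T, inner ℝ (h t) (a t - y t (Sum.inl ())) +
        ∑ t ∈ range T, inner ℝ (h t) (y t (Sum.inl ()) - u) := by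
    rw [← sum_add_distrib]
    refine sum_congr rfl fun t _ => ?_
    rw [← inner_add_right, sub_add_sub_cancel]
  have hGD : 0 < 4 * G * D := by positivity
  have h4 : (∑ t ∈ range T, inner ℝ (h t) (a t - y t (Sum.inl ())) ^ 2) / (4 * G * D) ^ 2 ≤
      T / 4 := by
    rw [div_le_iff₀ (by positivity)]
    have hterm : ∀ t ∈ range T, inner ℝ (h t) (a t - y t (Sum.inl ())) ^ 2 ≤ (2 * G * D) ^ 2 := by
      intro t ht
      have ht' := mem_range.1 ht
      rw [← sq_abs]
      refine pow_le_pow_left₀ (abs_nonneg _) ((abs_real_inner_le_norm _ _).trans ?_) 2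
      have h5 : ‖a t - y t (Sum.inl ())‖ ≤ 2 * D := (norm_sub_le _ _).trans
        (by linarith [H.norm_agg_le t ht', H.norm_expert_le t ht'.le (Sum.inl ())])
      calc _ ≤ G * (2 * D) := mul_le_mul (H.norm_grad_le t ht') h5 (norm_nonneg _) hG.le
        _ = _ := by ring
    refine (sum_le_sum hterm).trans (le_of_eq ?_)
    rw [sum_const, card_range, nsmul_eq_mul]
    ring
  have h5 : √(1 + (∑ t ∈ range T, inner ℝ (h t) (a t - y t (Sum.inl ())) ^ 2) /
      (4 * G * D) ^ 2) ≤ 1 + √(T : ℝ) / 2 := by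
    refine Real.sqrt_le_iff.2 ⟨by positivity, ?_⟩
    have hs : √(T : ℝ) ^ 2 = T := Real.sq_sqrt (by positivity)
    have hs0 := Real.sqrt_nonneg (T : ℝ)
    nlinarith
  have hΓ := metaGamma_nonneg hT
  have h6 : 4 * G * D * (metaGamma T * (2 + √(1 + (∑ t ∈ range T,
      inner ℝ (h t) (a t - y t (Sum.inl ())) ^ 2) / (4 * G * D) ^ 2) /
        √(Real.log (numExperts T)))) ≤ 4 * G * D * (metaGamma T * (2 + (1 + √(T : ℝ) / 2) /
          √(Real.log (numExperts T)))) := by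
    gcongr
  have h7 : 4 * G * D * (metaGamma T * (2 + (1 + √(T : ℝ) / 2) / √(Real.log (numExperts T)))) =
      4 * metaGamma T * G * D * (2 + 1 / √(Real.log (numExperts T))) +
        2 * metaGamma T * G * D / √(Real.log (numExperts T)) * √(T : ℝ) := by
    ring
  rw [h3]
  linarith

/-- The right side of `IsExpConcaveOn.sub_le_inner_add_expLoss`, summed over all rounds, for the expert
with modulus number `k`. -/
theorem sum_meta_add_expLoss_le (H : IsUniversalRun G D T x a h y S) (hG : 0 < G) (hD : 0 < D)
    (hT : 2 ≤ T) (hu : ‖u‖ ≤ D) (k : Grid T) {β : ℝ} (hβ : β = expBeta G D (modulus T k))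
    (hβ0 : 0 < β) (hβGD : β * (2 * G * D) ≤ 1 / 4) :
    ∑ t ∈ range T, (inner ℝ (h t) (a t - y t (Sum.inr (Sum.inl k))) -
        β / 16 * inner ℝ (h t) (a t - y t (Sum.inr (Sum.inl k))) ^ 2 +
      (inner ℝ (expLossGrad β (h t) (a t) (y t (Sum.inr (Sum.inl k))))
          (y t (Sum.inr (Sum.inl k)) - u) -
        β / 2 * inner ℝ (expLossGrad β (h t) (a t) (y t (Sum.inr (Sum.inl k))))
          (y t (Sum.inr (Sum.inl k)) - u) ^ 2)) ≤
      60 * (G * D) * Real.log (numExperts T) + 100 * (Real.log (numExperts T) * (1 / β)) +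
        1 / 2 * (d * Real.log (1 + T)) * (1 / β) + 2 * (1 / β) := by
  have hq : ∀ t < T, β * D * ‖expLossGrad β (h t) (a t) (y t (Sum.inr (Sum.inl k)))‖ ≤ 1 := by
    intro t ht
    have hh := H.norm_grad_le t ht
    have h1 : ‖y t (Sum.inr (Sum.inl k)) - a t‖ ≤ 2 * D := (norm_sub_le _ _).trans
      (by linarith [H.norm_agg_le t ht, H.norm_expert_le t ht.le (Sum.inr (Sum.inl k))])
    have h2 : |β * inner ℝ (h t) (y t (Sum.inr (Sum.inl k)) - a t)| ≤ 1 / 4 := by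
      rw [abs_mul, abs_of_pos hβ0]
      refine (mul_le_mul_of_nonneg_left ((abs_real_inner_le_norm _ _).trans ?_) hβ0.le).trans hβGD
      calc _ ≤ G * (2 * D) := mul_le_mul hh h1 (norm_nonneg _) hG.le
        _ = _ := by ring
    have h3 : ‖expLossGrad β (h t) (a t) (y t (Sum.inr (Sum.inl k)))‖ ≤ G + 1 / 4 * G := by
      refine (norm_add_le _ _).trans (add_le_add hh ?_)
      rw [norm_smul, Real.norm_eq_abs]
      exact mul_le_mul h2 hh (norm_nonneg _) (by norm_num)
    have h4 := mul_le_mul_of_nonneg_left h3 (show 0 ≤ β * D by positivity)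
    linarith
  have h1 := sum_inner_onsStep_le (y := fun t => y t (Sum.inr (Sum.inl k))) (h := h) (a := a)
    (S := fun t => S t k) hD hβ0 hu (H.norm_expert_le 0 (by omega) _)
    (by rw [H.mat_zero k, hβ]) hq
    (fun t ht => by rw [H.mat_step t ht k, hβ]) (fun t ht => by rw [H.exp_step t ht k, hβ])
  have h2 := (H.meta_regret (Sum.inr (Sum.inl k))).trans (mul_metaGamma_mul_le hG hD
    (show 0 < β / 8 by positivity) (sum_nonneg fun t _ => sq_nonneg _) hT)
  have h3 : 25 / 2 * (Real.log (numExperts T) / (β / 8)) =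
      100 * (Real.log (numExperts T) * (1 / β)) := by
    field_simp
    ring
  rw [sum_add_distrib, sum_sub_distrib, ← mul_sum]
  rw [h3] at h2
  have h4 : 1 / (2 * β) * (d * Real.log (1 + T)) + 2 / β =
      1 / 2 * (d * Real.log (1 + T)) * (1 / β) + 2 * (1 / β) := by
    field_simp
  rw [h4] at h1
  linarith

/-- The right side of `sub_le_of_strongConvex`, summed over all rounds, for the expert with modulus
number `k`. -/
theorem sum_meta_add_strongLoss_le (H : IsUniversalRun G D T x a h y S) (hG : 0 < G) (hD : 0 < D)
    (hT : 2 ≤ T) (hu : ‖u‖ ≤ D) (hx : ∀ t < T, ‖x t‖ ≤ D) (k : Grid T) {c : ℝ} (hc : 0 < c)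
    (hk : 0 < modulus T k) (hk' : modulus T k ≤ 1) :
    ∑ t ∈ range T, (inner ℝ (h t) (a t - y t (Sum.inr (Sum.inr k))) -
        c / 2 * inner ℝ (h t) (a t - y t (Sum.inr (Sum.inr k))) ^ 2 +
      (inner ℝ (h t + modulus T k • (y t (Sum.inr (Sum.inr k)) - x t))
          (y t (Sum.inr (Sum.inr k)) - u) -
        modulus T k / 2 * ‖y t (Sum.inr (Sum.inr k)) - u‖ ^ 2)) ≤
      60 * (G * D) * Real.log (numExperts T) + 25 / 2 * (Real.log (numExperts T) * (1 / c)) +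
        (G + 2 * D) ^ 2 / 2 * (1 + Real.log T) * (1 / modulus T k) := by
  have hq : ∀ t < T, ‖h t + modulus T k • (y t (Sum.inr (Sum.inr k)) - x t)‖ ≤ G + 2 * D := by
    intro t ht
    refine (norm_add_le _ _).trans (add_le_add (H.norm_grad_le t ht) ?_)
    have h1 : ‖y t (Sum.inr (Sum.inr k)) - x t‖ ≤ 2 * D := (norm_sub_le _ _).trans
      (by linarith [hx t ht, H.norm_expert_le t ht.le (Sum.inr (Sum.inr k))])
    rw [norm_smul, Real.norm_of_nonneg hk.le]
    have := mul_le_mul hk' h1 (norm_nonneg _) zero_le_one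
    linarith
  have h1 := sum_inner_ogdStrongStep_le (y := fun t => y t (Sum.inr (Sum.inr k))) (h := h)
    (x := x) hD.le hk hu hq (fun t ht => H.strong_step t ht k)
  have h2 := (H.meta_regret (Sum.inr (Sum.inr k))).trans (mul_metaGamma_mul_le hG hD
    hc (sum_nonneg fun t _ => sq_nonneg _) hT)
  have h3 : (G + 2 * D) ^ 2 / (2 * modulus T k) * (1 + Real.log T) =
      (G + 2 * D) ^ 2 / 2 * (1 + Real.log T) * (1 / modulus T k) := by
    field_simp
  rw [sum_add_distrib, sum_sub_distrib, ← mul_sum]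
  rw [h3] at h1
  rw [div_eq_mul_one_div (Real.log _) c] at h2
  linarith

end IsUniversalRun

theorem expBeta_pos {G D α : ℝ} (hG : 0 < G) (hD : 0 < D) (hα : 0 < α) : 0 < expBeta G D α := by
  unfold expBeta
  have : 0 < min (1 / (4 * G * D)) α := lt_min (by positivity) hα
  positivity

theorem one_div_expBeta_le {G D α α' : ℝ} (hG : 0 < G) (hD : 0 < D) (hα' : 0 < α')
    (hα : 0 < α) (h : α ≤ 2 * α') (h1 : α ≤ 1) :
    1 / expBeta G D α' ≤ (8 * (G * D) + 4) * (1 / α) := by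
  have hGD : 0 < G * D := by positivity
  rw [mul_one_div, div_le_div_iff₀ (expBeta_pos hG hD hα') hα]
  unfold expBeta
  rcases min_choice (1 / (4 * G * D)) α' with hm | hm <;> rw [hm]
  · have : (8 * (G * D) + 4) * (1 / 2 * (1 / (4 * G * D))) = 1 + 1 / (2 * (G * D)) := by
      field_simp
      ring
    rw [this]
    have : 0 < 1 / (2 * (G * D)) := by positivity
    linarith
  · nlinarith

/-- The bound for convex losses is of order `√(T log log T)`. The ratio of `log |A|` and
`log log T` is at most `1 + log 14 / log log T`, and this is largest for `T = 3`. -/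
theorem convex_bound_le {G D : ℝ} (hG : 0 < G) (hD : 0 < D) {T : ℕ} (hT : 3 ≤ T) :
    4 * metaGamma T * G * D * (2 + 1 / √(Real.log (numExperts T))) +
        (2 * metaGamma T * G * D / √(Real.log (numExperts T)) + 2 * D ^ 2 + G ^ 2) * √(T : ℝ) -
        G ^ 2 / 2 ≤
      (250 * (G * D) + 2 * D ^ 2 + G ^ 2) *
        √(1 + Real.log 14 / Real.log (Real.log 3)) * √(T * Real.log (Real.log T)) := by
  have hT2 : 2 ≤ T := by omega
  have hL := one_le_log_numExperts hT2
  have hΓ := metaGamma_le hT2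
  have h3 : 1 < Real.log 3 := by
    rw [Real.lt_log_iff_exp_lt (by norm_num)]
    linarith [Real.exp_one_lt_d9]
  have hl3 : 0 < Real.log (Real.log 3) := Real.log_pos h3
  have hT3 : Real.log 3 ≤ Real.log T := Real.log_le_log (by norm_num) (by exact_mod_cast hT)
  have hl : Real.log (Real.log 3) ≤ Real.log (Real.log T) := Real.log_le_log (by linarith) hT3
  have hK := numExperts_le_log hT2
  have h5 : (5 : ℝ) ≤ numExperts T := by exact_mod_cast five_le_numExperts hT2
  have h14 : 0 ≤ Real.log 14 := Real.log_nonneg (by norm_num)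
  set k := 1 + Real.log 14 / Real.log (Real.log 3) with hk
  set l := Real.log (Real.log T) with hldef
  have hLk : Real.log (numExperts T) ≤ k * l := by
    have h1 : Real.log (numExperts T) ≤ Real.log (14 * Real.log T) :=
      Real.log_le_log (by linarith) hK
    rw [Real.log_mul (by norm_num) (by linarith), ← hldef] at h1
    have h2 : Real.log 14 ≤ Real.log 14 / Real.log (Real.log 3) * l := by
      rw [div_mul_eq_mul_div, le_div_iff₀ hl3]
      exact mul_le_mul_of_nonneg_left hl h14
    rw [hk, add_mul, one_mul]
    linarith
  have hLT : Real.log (numExperts T) ≤ 16 * T := by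
    have := log_numExperts_le hT2
    have := Real.log_le_self (Nat.cast_nonneg (α := ℝ) T)
    linarith [Nat.cast_nonneg (α := ℝ) T]
  have hk0 : 0 ≤ k := add_nonneg zero_le_one (div_nonneg h14 hl3.le)
  have hkl : 0 ≤ k * l := mul_nonneg hk0 (hl3.le.trans hl)
  set L := Real.log (numExperts T)
  set p := √L
  have hp : 1 ≤ p := Real.one_le_sqrt.2 hL
  have hp2 : p ^ 2 = L := Real.sq_sqrt (by linarith)
  set s := √(T : ℝ)
  have hs : 0 ≤ s := Real.sqrt_nonneg _
  have hps : p ≤ 4 * s := by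
    refine (Real.sqrt_le_sqrt hLT).trans (le_of_eq ?_)
    rw [Real.sqrt_mul (by norm_num), show (16 : ℝ) = 4 ^ 2 by norm_num,
      Real.sqrt_sq (by norm_num)]
  have hR : p * s ≤ √k * √(T * l) := by
    have h1 : p ≤ √(k * l) := Real.sqrt_le_sqrt hLk
    refine (mul_le_mul_of_nonneg_right h1 hs).trans (le_of_eq ?_)
    rw [← Real.sqrt_mul hkl, ← Real.sqrt_mul hk0]
    congr 1
    ring
  have hGD : 0 < G * D := by positivity
  have h6 : 4 * metaGamma T * G * D * (2 + 1 / p) ≤ 240 * (G * D) * (p * s) := by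
    have h7 : 1 / p ≤ 1 := (div_le_one (by linarith)).2 hp
    calc 4 * metaGamma T * G * D * (2 + 1 / p) = 4 * (G * D) * (metaGamma T * (2 + 1 / p)) := by ring
      _ ≤ 4 * (G * D) * (5 * p ^ 2 * 3) := by
          have h8 : metaGamma T * (2 + 1 / p) ≤ 5 * p ^ 2 * 3 := by
            rw [hp2]
            exact mul_le_mul hΓ (by linarith) (by positivity) (by linarith)
          exact mul_le_mul_of_nonneg_left h8 (by positivity)
      _ ≤ 240 * (G * D) * (p * s) := by
          have : p ^ 2 ≤ 4 * (p * s) := by nlinarith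
          nlinarith
  have h7 : 2 * metaGamma T * G * D / p ≤ 10 * (G * D) * p := by
    rw [div_le_iff₀ (by linarith)]
    have := mul_le_mul_of_nonneg_left hΓ (show 0 ≤ 2 * (G * D) by positivity)
    rw [← hp2] at this
    linarith
  have h8 : (2 * metaGamma T * G * D / p + 2 * D ^ 2 + G ^ 2) * s ≤
      (10 * (G * D) + 2 * D ^ 2 + G ^ 2) * (p * s) := by
    have h9 : 2 * metaGamma T * G * D / p + 2 * D ^ 2 + G ^ 2 ≤
        (10 * (G * D) + 2 * D ^ 2 + G ^ 2) * p := by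
      have : 0 ≤ (2 * D ^ 2 + G ^ 2) * (p - 1) := mul_nonneg (by positivity) (by linarith)
      linarith
    have := mul_le_mul_of_nonneg_right h9 hs
    linarith
  have h9 := mul_le_mul_of_nonneg_left hR
    (show 0 ≤ 250 * (G * D) + 2 * D ^ 2 + G ^ 2 by positivity)
  have h10 : 0 ≤ G ^ 2 / 2 := by positivity
  rw [mul_assoc (250 * (G * D) + 2 * D ^ 2 + G ^ 2)]
  linarith

/-- The bound for exp-concave losses, with `b = 1 / β`, is of order `d / α * log T`. -/
theorem exp_bound_le {G D α b : ℝ} (hG : 0 < G) (hD : 0 < D) {d T : ℕ} (hd : 1 ≤ d) (hT : 2 ≤ T)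
    (hα : 0 < α) (hα1 : α ≤ 1) (hb0 : 0 ≤ b) (hb : b ≤ (8 * (G * D) + 4) * (1 / α)) :
    60 * (G * D) * Real.log (numExperts T) + 100 * (Real.log (numExperts T) * b) +
        1 / 2 * (d * Real.log (1 + T)) * b + 2 * b ≤
      (840 * (G * D) + 1405 * (8 * (G * D) + 4)) * (d / α * Real.log T) := by
  have hL := log_numExperts_le hT
  have hl := half_le_log hT
  have hlog : Real.log (1 + T) ≤ 2 * Real.log T := by
    have hT' : (2 : ℝ) ≤ T := by exact_mod_cast hT
    have h1 : Real.log (1 + T) ≤ Real.log ((T : ℝ) ^ 2) :=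
      Real.log_le_log (by positivity) (by nlinarith)
    rwa [Real.log_pow] at h1
  set l := Real.log T
  have hd' : (1 : ℝ) ≤ d := by exact_mod_cast hd
  have hGD : 0 < G * D := by positivity
  have hα' : 1 ≤ 1 / α := by rwa [le_div_iff₀ hα, one_mul]
  have hm : 1 ≤ d / α := by rw [le_div_iff₀ hα]; linarith
  set B := 8 * (G * D) + 4 with hB
  have hB0 : 0 < B := by rw [hB]; positivity
  -- every term is a multiple of `d b l`, and `d b ≤ B d / α`
  have h1 : b ≤ d * b := le_mul_of_one_le_left hb0 hd'
  have h2 : d * b ≤ B * (d / α) := by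
    refine (mul_le_mul_of_nonneg_left hb (by linarith)).trans (le_of_eq ?_)
    ring
  have h3 : Real.log (numExperts T) * b ≤ 14 * l * (d * b) :=
    mul_le_mul hL h1 hb0 (by linarith)
  have h4 : 1 / 2 * (d * Real.log (1 + T)) * b ≤ l * (d * b) := by
    have := mul_le_mul_of_nonneg_right hlog (show 0 ≤ d * b by positivity)
    linarith
  have h5 : 2 * b ≤ 4 * l * (d * b) := by
    have : 0 ≤ (4 * l - 2) * (d * b) := mul_nonneg (by linarith) (by positivity)
    linarith
  have h6 : l * (d * b) ≤ l * (B * (d / α)) := mul_le_mul_of_nonneg_left h2 (by linarith)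
  have h7 : 60 * (G * D) * Real.log (numExperts T) ≤ 840 * (G * D) * (d / α * l) := by
    have h8 : l ≤ d / α * l := le_mul_of_one_le_left (by linarith) hm
    have h9 := mul_le_mul_of_nonneg_left (hL.trans (mul_le_mul_of_nonneg_left h8 (by norm_num)))
      (show 0 ≤ 60 * (G * D) by positivity)
    linarith
  linarith

/-- The bound for strongly convex losses is of order `1 / lam * log T`; here `m` is the inverse of the
modulus of the expert, and `b` the inverse of the multiple of the sum of squares that is charged to
the curvature. -/
theorem strong_bound_le {G D lam b m : ℝ} (hG : 0 < G) (hD : 0 < D) {T : ℕ} (hT : 2 ≤ T)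
    (hlam : 0 < lam) (hlam1 : lam ≤ 1) (hb0 : 0 ≤ b) (hb : b ≤ (4 * G ^ 2 + 2 * (G * D)) * (1 / lam))
    (hm : m ≤ 2 * (1 / lam)) :
    60 * (G * D) * Real.log (numExperts T) + 25 / 2 * (Real.log (numExperts T) * b) +
        (G + 2 * D) ^ 2 / 2 * (1 + Real.log T) * m ≤
      (840 * (G * D) + 175 * (4 * G ^ 2 + 2 * (G * D)) + 3 * (G + 2 * D) ^ 2) *
        (1 / lam * Real.log T) := by
  have hL := log_numExperts_le hT
  have hl := half_le_log hT
  set l := Real.log T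
  have hlam' : 1 ≤ 1 / lam := by rwa [le_div_iff₀ hlam, one_mul]
  set r := 1 / lam
  have h1 : Real.log (numExperts T) * b ≤ 14 * l * ((4 * G ^ 2 + 2 * (G * D)) * r) :=
    mul_le_mul hL hb hb0 (by linarith)
  have h2 : (G + 2 * D) ^ 2 / 2 * (1 + l) * m ≤ (G + 2 * D) ^ 2 / 2 * (3 * l) * (2 * r) := by
    have h3 : (G + 2 * D) ^ 2 / 2 * (1 + l) ≤ (G + 2 * D) ^ 2 / 2 * (3 * l) :=
      mul_le_mul_of_nonneg_left (by linarith) (by positivity)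
    refine (mul_le_mul_of_nonneg_left hm ?_).trans (mul_le_mul_of_nonneg_right h3 (by linarith))
    exact mul_nonneg (by positivity) (by linarith)
  have h4 : 60 * (G * D) * Real.log (numExperts T) ≤ 840 * (G * D) * (r * l) := by
    have h5 : l ≤ r * l := le_mul_of_one_le_left (by linarith) hlam'
    have h6 := mul_le_mul_of_nonneg_left (hL.trans (mul_le_mul_of_nonneg_left h5 (by norm_num)))
      (show 0 ≤ 60 * (G * D) by positivity)
    linarith
  linarith

theorem RegretAtMost.mono {d : ℕ} {X : Set (Vec d)} {T : ℕ} {f : ℕ → Vec d → ℝ} {x : ℕ → Vec d}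
    {B B' : ℝ} (h : RegretAtMost X T f x B) (hB : B ≤ B') : RegretAtMost X T f x B' :=
  fun u hu => (h u hu).trans hB

/-- A bound `r u t` on the regret of each round with respect to `u` yields one on the total regret. -/
theorem regretAtMost_of_forall_le {d : ℕ} {X : Set (Vec d)} {T : ℕ} {f : ℕ → Vec d → ℝ}
    {x : ℕ → Vec d} {B : ℝ} {r : Vec d → ℕ → ℝ} (h : ∀ u ∈ X, ∀ t < T, f t (x t) - f t u ≤ r u t)
    (hr : ∀ u ∈ X, ∑ t ∈ range T, r u t ≤ B) : RegretAtMost X T f x B := by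
  intro u hu
  rw [← sum_sub_distrib]
  exact (sum_le_sum fun t ht => h u hu t (mem_range.1 ht)).trans (hr u hu)

theorem theorem1 (G D : ℝ) (hG : 0 < G) (hD : 0 < D) :
    ∃ C : ℝ, ∀ (d T : ℕ), 2 ≤ T →
      ∀ (X : Set (Vec d)), Convex ℝ X → IsClosed X → 0 ∈ X →
      (∀ x ∈ X, ∀ y ∈ X, ‖x - y‖ ≤ D) →
      ∀ (P : Vec d → Vec d), IsProjectionOnto X P →
      ∀ (f : ℕ → Vec d → ℝ) (df : ℕ → Vec d → Vec d),
      (∀ t < T, ∀ x ∈ X, HasGradientWithinAt (f t) (df t x) X x ∧ ‖df t x‖ ≤ G) →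
      ∀ (y₁ : Expert T → Vec d), (∀ i, ‖y₁ i‖ ≤ D) →
      -- every decision is feasible and costs exactly one projection onto the domain
      (∀ t < T, (universalAlgorithm G D T y₁).decision P df t ∈ X ∧
        (universalAlgorithm G D T y₁).projections P df t = 1) ∧
      -- general convex losses
      ((∀ t < T, ConvexOn ℝ X (f t)) →
        RegretAtMost X T f ((universalAlgorithm G D T y₁).decision P df)
          (4 * metaGamma T * G * D * (2 + 1 / √(Real.log (numExperts T))) +
            (2 * metaGamma T * G * D / √(Real.log (numExperts T)) + 2 * D ^ 2 + G ^ 2) * √(T : ℝ) -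
            G ^ 2 / 2) ∧
        (3 ≤ T → RegretAtMost X T f ((universalAlgorithm G D T y₁).decision P df)
          (C * √(T * Real.log (Real.log T))))) ∧
      -- exponentially concave losses
      (∀ α : ℝ, 1 / (T : ℝ) ≤ α → α ≤ 1 → (∀ t < T, IsExpConcaveOn X α (f t)) →
        RegretAtMost X T f ((universalAlgorithm G D T y₁).decision P df)
          (C * (d / α * Real.log T))) ∧
      -- strongly convex losses
      (∀ lam : ℝ, 1 / (T : ℝ) ≤ lam → lam ≤ 1 →
        (∀ t < T, IsStronglyConvexOn X lam (f t) (df t)) →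
        RegretAtMost X T f ((universalAlgorithm G D T y₁).decision P df)
          (C * (1 / lam * Real.log T))) := by
  have hGD : 0 < G * D := by positivity
  set C₁ : ℝ := (250 * (G * D) + 2 * D ^ 2 + G ^ 2) * √(1 + Real.log 14 / Real.log (Real.log 3))
    with hC₁
  set C₂ : ℝ := 840 * (G * D) + 1405 * (8 * (G * D) + 4) with hC₂
  set C₃ : ℝ := 840 * (G * D) + 175 * (4 * G ^ 2 + 2 * (G * D)) + 3 * (G + 2 * D) ^ 2 with hC₃
  have hC₁0 : 0 ≤ C₁ := by positivity
  have hC₂0 : 0 ≤ C₂ := by positivity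
  have hC₃0 : 0 ≤ C₃ := by positivity
  refine ⟨C₁ + C₂ + C₃, fun d T hT X hX _ hX0 hdiam P hP f df hf y₁ hy₁ => ?_⟩
  have hnorm : ∀ z ∈ X, ‖z‖ ≤ D := fun z hz => by simpa using hdiam z hz 0 hX0
  set x := (universalAlgorithm G D T y₁).decision P df with hx
  set a : ℕ → Vec d := fun t =>
    ((universalAlgorithm G D T y₁).stateAt P df t : UniState d T).aggregate
  set h := runGrad G D y₁ P df
  have hxX : ∀ t, x t ∈ X := fun t => (hP _).1
  have H := isUniversalRun (P := P) (df := df) hG hD hT hy₁ fun t ht => (hf t ht _ (hxX t)).2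
  have hproj : ∀ t, ∀ u ∈ X, inner ℝ (df t (x t)) (x t - u) ≤ inner ℝ (h t) (x t - u) :=
    fun t u hu => inner_le_inner_surrogateGrad _ (hP.inner_sub_sub_le_zero hX (a t) hu)
  have hout : ∀ t, 0 ≤ inner ℝ (h t) (a t - x t) := fun t => inner_surrogateGrad_sub_nonneg _ _ _
  have hsurr : ∀ t, ∀ u ∈ X, inner ℝ (df t (x t)) (x t - u) ≤ inner ℝ (h t) (a t - u) := by
    intro t u hu
    rw [← sub_add_sub_cancel (a t) (x t) u, inner_add_right]
    linarith [hproj t u hu, hout t]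
  have hl := half_le_log hT
  refine ⟨fun t _ => ⟨hxX t, projections_eq_one G D y₁ P df t⟩, fun hconv => ?_,
    fun α hα hα1 hexp => ?_, fun lam hlam hlam1 hstr => ?_⟩
  · have hreg := regretAtMost_of_forall_le
      (fun u hu t ht => ((hconv t ht).sub_le_inner (hxX t) hu (hf t ht _ (hxX t)).1).trans
        (hsurr t u hu))
      (fun u hu => H.sum_inner_le_of_convex hG hD hT (hnorm u hu))
    refine ⟨hreg, fun hT3 => hreg.mono ((convex_bound_le hG hD hT3).trans ?_)⟩
    exact mul_le_mul_of_nonneg_right (by linarith) (Real.sqrt_nonneg _)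
  · rcases Nat.eq_zero_or_pos d with rfl | hd
    · -- there is only one point
      intro u _
      have : ∀ t, x t = u := fun t => Subsingleton.elim _ _
      simp [this]
    obtain ⟨k, hk0, hk, hk2⟩ := exists_modulus_le hT hα hα1
    have hα0 : 0 < α := hk0.trans_le hk
    set β := expBeta G D (modulus T k) with hβ
    have hβ0 : 0 < β := expBeta_pos hG hD hk0
    have hβα : 2 * β ≤ α := by
      have : min (1 / (4 * G * D)) (modulus T k) ≤ modulus T k := min_le_right _ _
      rw [hβ, expBeta]
      linarith
    have hβGD : β * (2 * G * D) ≤ 1 / 4 := by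
      have h1 : min (1 / (4 * G * D)) (modulus T k) ≤ 1 / (4 * G * D) := min_le_left _ _
      have h2 := mul_le_mul_of_nonneg_right h1 (show 0 ≤ G * D by positivity)
      have h3 : 1 / (4 * G * D) * (G * D) = 1 / 4 := by field_simp
      rw [hβ, expBeta]
      linarith
    have hreg := regretAtMost_of_forall_le
      (fun u hu t ht => (hexp t ht).sub_le_inner_add_expLoss hβ0 hβα hβGD (hxX t) hu
        (hf t ht _ (hxX t)).1 (hsurr t u hu) (H.norm_grad_le t ht) (H.norm_agg_le t ht)
        (H.norm_expert_le t ht.le (Sum.inr (Sum.inl k))) (hnorm u hu))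
      (fun u hu => H.sum_meta_add_expLoss_le hG hD hT (hnorm u hu) k hβ hβ0 hβGD)
    refine hreg.mono ((exp_bound_le hG hD hd hT hα0 hα1 (by positivity)
      (one_div_expBeta_le hG hD hk0 hα0 hk2 hα1)).trans ?_)
    exact mul_le_mul_of_nonneg_right (by linarith)
      (mul_nonneg (by positivity) (by linarith))
  · obtain ⟨k, hk0, hk, hk2⟩ := exists_modulus_le hT hlam hlam1
    have hlam0 : 0 < lam := hk0.trans_le hk
    -- the largest `c` with `2 c G² ≤ modulus` and `2 c G D ≤ 1`, up to a constant factor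
    obtain ⟨c, hc0, hc1, hc2, hc3⟩ : ∃ c : ℝ, 0 < c ∧ 2 * c * G ^ 2 ≤ modulus T k ∧
        2 * c * (G * D) ≤ 1 ∧ 1 / c ≤ (4 * G ^ 2 + 2 * (G * D)) * (1 / lam) := by
      have hpos : 0 < 4 * G ^ 2 + 2 * (G * D) := by positivity
      have hcancel : lam / (4 * G ^ 2 + 2 * (G * D)) * (4 * G ^ 2 + 2 * (G * D)) = lam :=
        div_mul_cancel₀ _ hpos.ne'
      have hc0 : 0 < lam / (4 * G ^ 2 + 2 * (G * D)) := by positivity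
      refine ⟨lam / (4 * G ^ 2 + 2 * (G * D)), hc0, ?_, ?_, ?_⟩
      · nlinarith [mul_pos hc0 hGD]
      · nlinarith [mul_pos hc0 (pow_pos hG 2)]
      · rw [one_div_div, mul_one_div]
    have hreg := regretAtMost_of_forall_le (x := x)
      (fun u hu t ht => sub_le_of_strongConvex (F := f t (x t) - f t u)
        (y := ((universalAlgorithm G D T y₁).stateAt P df t : UniState d T).expert
          (Sum.inr (Sum.inr k))) hc0.le hc1 hc2 (by
            have h1 := hstr t ht (x t) (hxX t) u hu
            rw [← neg_sub (x t) u, inner_neg_right, norm_neg] at h1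
            have h2 := mul_le_mul_of_nonneg_right hk (sq_nonneg ‖u - x t‖)
            rw [norm_sub_rev (x t) u] at h1
            linarith) (hproj t u hu) (hout t) (H.norm_grad_le t ht)
        ((norm_sub_le _ _).trans (by linarith [H.norm_agg_le t ht, hnorm _ (hxX t)])))
      (fun u hu => H.sum_meta_add_strongLoss_le hG hD hT (hnorm u hu)
        (fun t _ => hnorm _ (hxX t)) k hc0 hk0 (hk.trans hlam1))
    have hm : 1 / modulus T k ≤ 2 * (1 / lam) := by
      rw [mul_one_div, div_le_div_iff₀ hk0 hlam0]
      linarith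
    refine hreg.mono ((strong_bound_le hG hD hT hlam0 hlam1 (by positivity) hc3 hm).trans ?_)
    exact mul_le_mul_of_nonneg_right (by linarith)
      (mul_nonneg (by positivity) (by linarith))
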